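/- **Setting.** Constants form a countably infinite set $\mathbf{Const}$ with a dense linear order (here: the finite binary strings). A schema $S$ consists of finitely many relation names with arities and a finite set of first-order integrity constraints; an instance $I$ of $S$ is a finite set of facts over $\mathbf{Const}$ that satisfies the constraints. An $S$-ontology is a triple $\mathcal O=(\mathcal C,\sqsubseteq,ext)$, where $\mathcal C$ is a possibly infinite set of concepts (named by binary strings), $\sqsubseteq$ is a pre-order on $\mathcal C$, and $ext$ assigns to each concept $C$ and each instance $I$ a set $ext(C,I)\subseteq\mathbf{Const}$ such that the question "$c\in ext(C,I)$?" is decided by a Turing machine in time polynomial in the size of $(C,I,c)$. The instance $I$ is consistent with $\mathcal O$ if $C_1\sqsubseteq C_2$ implies $ext(C_1,I)\subseteq ext(C_2,I)$. A why-not instance $(S,I,q,Ans,\bar a)$ consists of a schema $S$, an instance $I$ of $S$, an $m$-ary conjunctive query $q$, the finite set $Ans=q(I)$, and a tuple $\bar a=(a_1,\dots,a_m)\notin Ans$. An explanation is a tuple $E=(C_1,\dots,C_m)$ of concepts with $a_i\in ext(C_i,I)$ for all $i$ and $(ext(C_1,I)\times\dots\times ext(C_m,I))\cap Ans=\emptyset$.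 It is most general if there is no explanation $E'=(C_1',\dots,C_m')$ with $C_i\sqsubseteq C_i'$ for all $i$ but not $C_i'\sqsubseteq C_i$ for all $i$. Its degree of generality is the (possibly infinite) sum $\deg E=|ext(C_1,I)|+\dots+|ext(C_m,I)|$. It is $>^{card}$-maximal if no explanation has a strictly higher degree. **Theorem.** Assume $\mathrm P\neq\mathrm{NP}$. Then no polynomial-time algorithm takes as input a why-not instance $(S,I,q,Ans,\bar a)$ and an $S$-ontology $\mathcal O$ consistent with $I$, and produces a $>^{card}$-maximal explanation for $\bar a\notin Ans$ whenever there is one. Moreover, for every constant $r\ge 1$, no polynomial-time algorithm produces, whenever there is a $>^{card}$-maximal explanation, an explanation $E$ with $\deg E'\le r\cdot\deg E$ for all explanations $E'$. Both hold even for unary queries (and conjunctive queries without comparisons), and even for a single fixed pair $(S,\mathcal O)$, as follows. There are a schema $S$ and an $S$-ontology $\mathcal O$ with the following properties. 1. Membership in $\mathcal C$ is decidable in polynomial time. Each $ext(C,I)$ has polynomially many elements, each of polynomial length, in the size of $(C,I)$. For unary queries and consistent $I$, every explanation $E$ has a counterpart $E'$, an explanation of length polynomial in the size of the why-not instance with $\deg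 E\le\deg E'$, and a most-general explanation (if there is one) can be computed in polynomial time. 2. Take any format in which strings describe pairs of a schema and an ontology over it, and in which $(S,\mathcal O)$ has at least one description. Then no polynomial-time algorithm whose input consists of the description of a pair $(S',\mathcal O')$ and of a why-not instance over $S'$ with a unary comparison-free conjunctive query and with a database instance consistent with $\mathcal O'$ always produces a $>^{card}$-maximal explanation when one exists. Likewise, for every $r\ge1$, no such algorithm always produces, when a $>^{card}$-maximal explanation exists, an explanation whose degree is maximal up to the factor $r$. -/

import Mathlib

open Computability Turing

noncomputable section

namespace WhyNot

/-! ## Polynomial time, P and NP (multi-stack Turing machines of Mathlib) -/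

/-- `f` is computed by a Turing machine in time polynomial in the length of its input. -/
def PolyTime {A B : Type} (f : List A → List B) : Prop :=
  Nonempty (TM2ComputableInPolyTime (id : List A → List A) (id : List B → List B) f)

/-- The yes/no question `d` is decided by a Turing machine in polynomial time. -/
def PolyTimeDecidable {A : Type} (d : List A → Bool) : Prop :=
  Nonempty (TM2ComputableInPolyTime (id : List A → List A) encodeBool d)

/-- The class P of languages over the alphabet `Bool`. -/
def classP : Set (Language Bool) :=
  {L | ∃ d : List Bool → Bool, PolyTimeDecidable d ∧ ∀ x, x ∈ L ↔ d x = true}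

/-- The class NP: membership is witnessed by certificates of polynomial length that are verified
in polynomial time. The verifier reads the pair of the word and the certificate. -/
def classNP : Set (Language Bool) :=
  {L | ∃ (v : List Bool × List Bool → Bool) (p : Polynomial ℕ),
    Nonempty (TM2ComputableInPolyTime
      (encodingProd (encodingList Bool) (encodingList Bool)).encode encodeBool v) ∧
    ∀ x, x ∈ L ↔ ∃ y : List Bool, y.length ≤ p.eval x.length ∧ v (x, y) = true}

/-! ## Constants: a countably infinite set with a dense linear order

A constant is a finite binary string. Reading the string `b₁…bₖ` as the dyadic number
`0.b₁…bₖ1` in base two gives the order. -/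

/-- The constants. -/
@[ext] structure Const where
  /-- The string which the constant is. -/
  str : List Bool

/-- The dyadic number `0.b₁…bₖ1` of a string. -/
def dyadic : List Bool → ℚ
  | [] => 1 / 2
  | b :: w => ((if b then 1 else 0) + dyadic w) / 2

theorem dyadic_pos (w : List Bool) : 0 < dyadic w := by
  induction w with
  | nil => norm_num [dyadic]
  | cons b w ih => cases b <;> simp only [dyadic] <;> norm_num <;> linarith

theorem dyadic_lt_one (w : List Bool) : dyadic w < 1 := by
  induction w with
  | nil => norm_num [dyadic]
  | cons b w ih => cases b <;> simp only [dyadic] <;> norm_num <;> linarith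

theorem dyadic_injective : Function.Injective dyadic := by
  intro v
  induction v with
  | nil =>
    intro w h
    rcases w with _ | ⟨b, w⟩
    · rfl
    · have h0 := dyadic_pos w
      have h1 := dyadic_lt_one w
      cases b <;> norm_num [dyadic] at h <;> linarith
  | cons a v ih =>
    intro w h
    have h0 := dyadic_pos v
    have h1 := dyadic_lt_one v
    rcases w with _ | ⟨b, w⟩
    · cases a <;> norm_num [dyadic] at h <;> linarith
    · have h2 := dyadic_pos w
      have h3 := dyadic_lt_one w
      cases a <;> cases b <;> norm_num [dyadic] at h <;>
        first
        | (exfalso; linarith)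
        | (rw [ih (a₂ := w) (by linarith)])

theorem exists_dyadic_lt (w : List Bool) : ∃ u, dyadic u < dyadic w := by
  induction w with
  | nil => exact ⟨[false], by norm_num [dyadic]⟩
  | cons b w ih =>
    obtain ⟨u, hu⟩ := ih
    exact ⟨b :: u, by simp only [dyadic]; linarith⟩

theorem exists_lt_dyadic (w : List Bool) : ∃ u, dyadic w < dyadic u := by
  induction w with
  | nil => exact ⟨[true], by norm_num [dyadic]⟩
  | cons b w ih =>
    obtain ⟨u, hu⟩ := ih
    exact ⟨b :: u, by simp only [dyadic]; linarith⟩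

theorem dyadic_dense (v : List Bool) :
    ∀ w, dyadic v < dyadic w → ∃ u, dyadic v < dyadic u ∧ dyadic u < dyadic w := by
  induction v with
  | nil =>
    intro w h
    rcases w with _ | ⟨b, w⟩
    · exact absurd h (lt_irrefl _)
    · have h1 := dyadic_lt_one w
      obtain ⟨u, hu⟩ := exists_dyadic_lt w
      have hu0 := dyadic_pos u
      cases b
      · norm_num [dyadic] at h; linarith
      · exact ⟨true :: u, by norm_num [dyadic]; linarith, by norm_num [dyadic]; linarith⟩
  | cons a v ih =>
    intro w h
    have h0 := dyadic_pos v
    have h1 := dyadic_lt_one v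
    rcases w with _ | ⟨b, w⟩
    · obtain ⟨u, hu⟩ := exists_lt_dyadic v
      have hu1 := dyadic_lt_one u
      cases a
      · exact ⟨false :: u, by norm_num [dyadic]; linarith, by norm_num [dyadic]; linarith⟩
      · norm_num [dyadic] at h; linarith
    · have h2 := dyadic_pos w
      have h3 := dyadic_lt_one w
      by_cases hab : a = b
      · subst hab
        obtain ⟨u, hu, hu'⟩ := ih w (by simp only [dyadic] at h; linarith)
        exact ⟨a :: u, by simp only [dyadic]; linarith, by simp only [dyadic]; linarith⟩
      · cases a <;> cases b
        · exact absurd rfl hab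
        · exact ⟨[], by norm_num [dyadic]; linarith, by norm_num [dyadic]; linarith⟩
        · norm_num [dyadic] at h
          linarith
        · exact absurd rfl hab

instance : LinearOrder Const :=
  LinearOrder.lift' (fun c : Const => dyadic c.str)
    (fun _ _ h => Const.ext (dyadic_injective h))

instance : DenselyOrdered Const where
  dense c d h := by
    obtain ⟨u, h1, h2⟩ := dyadic_dense c.str d.str h
    exact ⟨⟨u⟩, h1, h2⟩

/-! ## Schemas and instances -/

/-- Finitely many relation names, each with an arity. -/
structure Signature where
  numRel : ℕ
  arity : Fin numRel → ℕ

/-- Constant symbols of the first-order language of a signature: all constants. -/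
inductive FOFunction : ℕ → Type
  | const (c : Const) : FOFunction 0

/-- Relation symbols of the first-order language of a signature: the relation names and the order
on the constants. -/
inductive FORelation (G : Signature) : ℕ → Type
  | rel (R : Fin G.numRel) : FORelation G (G.arity R)
  | less : FORelation G 2

/-- The first-order language in which integrity constraints are written. -/
def Signature.lang (G : Signature) : FirstOrder.Language where
  Functions := FOFunction
  Relations := FORelation G

/-- A schema: a signature and a finite set of first-order sentences, the integrity constraints. -/
structure Schema extends Signature where
  constraints : Finset toSignature.lang.Sentence

/-- A fact `R(b₁,…,bₖ)`. -/
structure Fact (G : Signature) where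
  rel : Fin G.numRel
  args : Fin (G.arity rel) → Const

/-- The first-order structure with domain `Const` given by a set of facts. -/
@[reducible] def factStructure {G : Signature} (F : Finset (Fact G)) : G.lang.Structure Const where
  funMap := fun f _ => match f with
    | FOFunction.const c => c
  RelMap := fun r v => match r with
    | FORelation.rel R => (⟨R, v⟩ : Fact G) ∈ F
    | FORelation.less => v 0 < v 1

/-- A database instance: a finite set of facts that satisfies the integrity constraints. -/
structure Instance (S : Schema) where
  facts : Finset (Fact S.toSignature)
  sat : ∀ φ ∈ S.constraints,
    @FirstOrder.Language.Sentence.Realize S.toSignature.lang Const (factStructure facts) φ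

/-! ## Conjunctive queries with comparisons to constants -/

/-- A variable or a constant. -/
inductive Term
  | var (n : ℕ)
  | const (c : Const)

/-- The value of a term under an assignment of the variables. -/
def Term.value (ν : ℕ → Const) : Term → Const
  | Term.var n => ν n
  | Term.const c => c

/-- An atom `R(t₁,…,tₖ)`. -/
structure Atom (G : Signature) where
  rel : Fin G.numRel
  args : Fin (G.arity rel) → Term

/-- Comparison operators. -/
inductive CompOp
  | eq
  | lt
  | gt
  | le
  | ge

/-- The meaning of a comparison operator. -/
def CompOp.Holds : CompOp → Const → Const → Prop
  | CompOp.eq, c, d => c = d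
  | CompOp.lt, c, d => c < d
  | CompOp.gt, c, d => c > d
  | CompOp.le, c, d => c ≤ d
  | CompOp.ge, c, d => c ≥ d

/-- A comparison `x op c` of a variable to a constant. -/
structure Comparison where
  var : ℕ
  op : CompOp
  const : Const

/-- An `m`-ary conjunctive query with comparisons to constants: the variables of `head` are the
free ones, all others are existentially quantified. Every free variable occurs in an atom. -/
structure CQ (G : Signature) (m : ℕ) where
  head : Fin m → ℕ
  atoms : List (Atom G)
  comparisons : List Comparison
  safe : ∀ i, ∃ A ∈ atoms, ∃ j, A.args j = Term.var (head i)

/-- The answers of a query over a finite set of facts. -/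
def CQ.answers {G : Signature} {m : ℕ} (q : CQ G m) (F : Finset (Fact G)) :
    Set (Fin m → Const) :=
  {t | ∃ ν : ℕ → Const,
    (∀ A ∈ q.atoms, (⟨A.rel, fun j => (A.args j).value ν⟩ : Fact G) ∈ F) ∧
    (∀ k ∈ q.comparisons, k.op.Holds (ν k.var) k.const) ∧
    t = fun i => ν (q.head i)}

/-- A why-not instance `(S, I, q, Ans, a)` for an `m`-ary query. -/
structure WhyNotInstance (S : Schema) (m : ℕ) where
  inst : Instance S
  query : CQ S.toSignature m
  ans : Finset (Fin m → Const)
  ans_eq : (ans : Set (Fin m → Const)) = query.answers inst.facts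
  tuple : Fin m → Const
  not_mem : tuple ∉ ans

/-! ## Inputs and outputs of algorithms as strings

Everything is written over Mathlib's alphabet `Γ'` of bits, brackets and separators. Numbers are
in binary. Sets are written as lists without repetition, in any order. -/

/-- A binary string in brackets. -/
def encStr (w : List Bool) : List Γ' :=
  Γ'.bra :: (w.map Γ'.bit ++ [Γ'.ket])

/-- A list of encoded objects, in brackets. -/
def encList (l : List (List Γ')) : List Γ' :=
  Γ'.bra :: (l.flatten ++ [Γ'.ket])

/-- A number in binary. -/
def encNum (n : ℕ) : List Γ' :=
  encStr (encodeNat n)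

/-- A tuple of constants. -/
def encConsts {k : ℕ} (t : Fin k → Const) : List Γ' :=
  encList (List.ofFn fun i => encStr (t i).str)

/-- A tuple of concepts. -/
def encConcepts {k : ℕ} (E : Fin k → List Bool) : List Γ' :=
  encList (List.ofFn fun i => encStr (E i))

def encFact {G : Signature} (f : Fact G) : List Γ' :=
  encList [encNum f.rel, encConsts f.args]

def encTerm : Term → List Γ'
  | Term.var n => encList [encNum 0, encNum n]
  | Term.const c => encList [encNum 1, encStr c.str]

def encAtom {G : Signature} (A : Atom G) : List Γ' :=
  encList [encNum A.rel, encList (List.ofFn fun j => encTerm (A.args j))]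

def encOp : CompOp → List Γ'
  | CompOp.eq => encNum 0
  | CompOp.lt => encNum 1
  | CompOp.gt => encNum 2
  | CompOp.le => encNum 3
  | CompOp.ge => encNum 4

def encComparison (k : Comparison) : List Γ' :=
  encList [encNum k.var, encOp k.op, encStr k.const.str]

def encCQ {G : Signature} {m : ℕ} (q : CQ G m) : List Γ' :=
  encList [encList (List.ofFn fun i => encNum (q.head i)), encList (q.atoms.map encAtom),
    encList (q.comparisons.map encComparison)]

/-- `l` lists the elements of `F` without repetition. -/
def Lists {A : Type} (l : List A) (F : Finset A) : Prop :=
  l.Nodup ∧ ∀ x, x ∈ l ↔ x ∈ F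

/-- The string `x` describes the database instance `I`. -/
def Instance.EncodedBy {S : Schema} (I : Instance S) (x : List Γ') : Prop :=
  ∃ l, Lists l I.facts ∧ x = encList (l.map encFact)

/-- The string `x` describes the items `I, q, Ans, a` of a why-not instance over a known schema. -/
def WhyNotInstance.EncodedBy {S : Schema} {m : ℕ} (w : WhyNotInstance S m) (x : List Γ') : Prop :=
  ∃ y l, w.inst.EncodedBy y ∧ Lists l w.ans ∧
    x = encList [y, encCQ w.query, encList (l.map encConsts), encConsts w.tuple]

/-! ## Ontologies and explanations -/

/-- An ontology over the schema `S`. Concepts are named by binary strings; there may be infinitely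
many of them. The question whether `c ∈ ext C I` is decided by a Turing machine in time polynomial
in the length of the input `C, I, c`. -/
structure Ontology (S : Schema) where
  concepts : Set (List Bool)
  sub : List Bool → List Bool → Prop
  sub_refl : ∀ C ∈ concepts, sub C C
  sub_trans : ∀ C ∈ concepts, ∀ D ∈ concepts, ∀ E ∈ concepts, sub C D → sub D E → sub C E
  ext : List Bool → Instance S → Set Const
  ext_polyTime : ∃ d : List Γ' → Bool, PolyTimeDecidable d ∧
    ∀ C ∈ concepts, ∀ (I : Instance S) (x : List Γ') (c : Const), I.EncodedBy x →
      (d (encList [encStr C, x, encStr c.str]) = true ↔ c ∈ ext C I)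

/-- `I` is consistent with `O`. -/
def Ontology.Consistent {S : Schema} (O : Ontology S) (I : Instance S) : Prop :=
  ∀ C ∈ O.concepts, ∀ D ∈ O.concepts, O.sub C D → O.ext C I ⊆ O.ext D I

section explanations

variable {S : Schema} {m : ℕ}

/-- The tuple `E` of concepts is an explanation for the missing tuple. -/
def IsExplanation (O : Ontology S) (w : WhyNotInstance S m) (E : Fin m → List Bool) : Prop :=
  (∀ i, E i ∈ O.concepts) ∧ (∀ i, w.tuple i ∈ O.ext (E i) w.inst) ∧
    ∀ t ∈ w.ans, ¬ ∀ i, t i ∈ O.ext (E i) w.inst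

/-- `E` is less general than `E'`. -/
def LessGeneral (O : Ontology S) (E E' : Fin m → List Bool) : Prop :=
  ∀ i, O.sub (E i) (E' i)

/-- `E` is a most-general explanation. -/
def IsMostGeneral (O : Ontology S) (w : WhyNotInstance S m) (E : Fin m → List Bool) : Prop :=
  IsExplanation O w E ∧
    ¬ ∃ E', IsExplanation O w E' ∧ LessGeneral O E E' ∧ ¬ LessGeneral O E' E

/-- The degree of generality: the sum, possibly infinite, of the cardinalities of the
extensions. -/
def degree (O : Ontology S) (I : Instance S) (E : Fin m → List Bool) : ℕ∞ :=
  ∑ i, (O.ext (E i) I).encard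

/-- `E` is an explanation and no explanation has a strictly higher degree of generality. -/
def IsCardMaximal (O : Ontology S) (w : WhyNotInstance S m) (E : Fin m → List Bool) : Prop :=
  IsExplanation O w E ∧
    ¬ ∃ E', IsExplanation O w E' ∧ degree O w.inst E < degree O w.inst E'

/-- `E` is an explanation whose degree of generality is maximal up to the factor `r`. -/
def IsCardApprox (r : ℕ) (O : Ontology S) (w : WhyNotInstance S m) (E : Fin m → List Bool) :
    Prop :=
  IsExplanation O w E ∧
    ∀ E', IsExplanation O w E' → degree O w.inst E' ≤ r * degree O w.inst E

end explanations

/-! ## Conditions that make an ontology tractable -/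

/-- Membership in the set of concepts is decidable in polynomial time. -/
def Ontology.ConceptsPolyTime {S : Schema} (O : Ontology S) : Prop :=
  ∃ d : List Bool → Bool, PolyTimeDecidable d ∧ ∀ C, C ∈ O.concepts ↔ d C = true

/-- Extensions have polynomially many elements, each of polynomial length. -/
def Ontology.SmallExtensions {S : Schema} (O : Ontology S) : Prop :=
  ∃ p : Polynomial ℕ, ∀ C ∈ O.concepts, ∀ (I : Instance S) (x : List Γ'), I.EncodedBy x →
    (O.ext C I).encard ≤ (p.eval (C.length + x.length) : ℕ) ∧
    ∀ c ∈ O.ext C I, c.str.length ≤ p.eval (C.length + x.length)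

/-- For unary queries: every explanation is matched, in degree of generality, by one of polynomial
length. -/
def Ontology.ShortExplanations {S : Schema} (O : Ontology S) : Prop :=
  ∃ p : Polynomial ℕ, ∀ (w : WhyNotInstance S 1) (x : List Γ'), O.Consistent w.inst →
    w.EncodedBy x → ∀ E, IsExplanation O w E →
      ∃ E', IsExplanation O w E' ∧ degree O w.inst E ≤ degree O w.inst E' ∧
        (E' 0).length ≤ p.eval x.length

/-- For unary queries: a most-general explanation, if there is one, can be computed in polynomial
time. -/
def Ontology.MostGeneralPolyTime {S : Schema} (O : Ontology S) : Prop :=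
  ∃ g : List Γ' → List Γ', PolyTime g ∧
    ∀ (w : WhyNotInstance S 1) (x : List Γ'), O.Consistent w.inst → w.EncodedBy x →
      (∃ E, IsMostGeneral O w E) → ∃ E, IsMostGeneral O w E ∧ g x = encConcepts E

/-! ## Algorithms that receive an ontology as part of their input -/

/-- A format for presenting schemas with ontologies to an algorithm: `F s = some ⟨S, O⟩` says
that the string `s` describes the schema `S` and the ontology `O` over it. -/
abbrev OntologyFormat := List Bool → Option (Σ S : Schema, Ontology S)

/-- The algorithm `A` reads a description of a schema `S` and an ontology `O`, and a why-not
instance `w` over `S` with a unary conjunctive query without comparisons, whose database instance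
is consistent with `O`. If there is a cardinality-maximal explanation at all, then `A` returns
an explanation `E` with `Good O w E`. -/
def Produces (F : OntologyFormat)
    (Good : ∀ {S : Schema}, Ontology S → WhyNotInstance S 1 → (Fin 1 → List Bool) → Prop)
    (A : List Γ' → List Γ') : Prop :=
  ∀ (s : List Bool) (S : Schema) (O : Ontology S), F s = some ⟨S, O⟩ →
    ∀ (w : WhyNotInstance S 1) (x : List Γ'), w.query.comparisons = [] →
      O.Consistent w.inst → w.EncodedBy x → (∃ E, IsCardMaximal O w E) →
        ∃ E, Good O w E ∧ A (encList [encStr s, x]) = encConcepts E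

end WhyNot

end

/-!
Let `L` be a language in NP that is not in P, with verifier `v` and bound `p` on the length of
certificates. A database instance is a single fact `R(x, b, z)`. The concept `true :: y` has the
extension `{1ⁱ : i ≤ |z|}` if `|y| ≤ |b|` and `v` accepts `(x, y)`, and is empty otherwise; the
concept `false :: c` is the nominal `{c}`. Different concepts are incomparable, so that every
instance is consistent, and the nominal of the missing constant is always a most-general
explanation, which can be copied from the input.

For a word `x` take the fact `R(x, 1ⁿ, 1ʳ)` with `n = p(|x|)`, a query without answers, and the
empty string as the missing constant. Its nominal is an explanation of degree `1`, and a
certificate for `x`, if there is one, is an explanation of degree `r + 1 > r · 1`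
(`isExplanation_certQuestion`, `degree_certQuestion_true`). An explanation that is maximal up to
the factor `r` is therefore a certificate if and only if `x ∈ L`, and the first letter of the
concept decides `L` (`mem_classP_of_produces`). Exact maximality is the case `r = 1`.

What has to be built is polynomial time for Mathlib's multi-stack machines. Functions computed in
polynomial time are closed under composition (`PolyTimeVia.comp`: the output of a machine is at
most as long as its input plus a constant times its running time). Three kinds of machines are
programmed directly: finite-state transducers (`polyTime_transduce`), the product of a list with
itself (`polyTime_product_self`), and reading several lists in parallel (`polyTime_columns`). All
other algorithms are compositions of these. Copies of a list, and hence the unary value of a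
polynomial, are cut out of products (`polyTime_partition`, `polyTime_unary_eval`). Membership in
an extension is decided by translating the question to one for the verifier, where questions that
are settled without it become a fixed pair that `v` accepts or rejects (`Decide.query_spec`); such
pairs exist, since otherwise `L` would be trivial. The inclusion of P in NP is needed to obtain
`L` from `P ≠ NP`.
-/

noncomputable section

namespace WhyNot

/-! ### Runs of machines -/

/-- `f` leads from `a` to `b` in exactly `n` steps. -/
def RunsIn {α : Type*} (f : α → Option α) (n : ℕ) (a b : α) : Prop :=
  (flip bind f)^[n] (some a) = some b

namespace RunsIn

variable {α : Type*} {f : α → Option α}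

theorem refl (a : α) : RunsIn f 0 a a := rfl

theorem head {n : ℕ} {a b c : α} (h : f a = some b) (h' : RunsIn f n b c) :
    RunsIn f (n + 1) a c := by
  unfold RunsIn at *
  rw [Function.iterate_succ_apply]
  have : flip bind f (some a) = some b := h
  rw [this, h']

theorem trans {m n : ℕ} {a b c : α} (h : RunsIn f m a b) (h' : RunsIn f n b c) :
    RunsIn f (m + n) a c := by
  unfold RunsIn at *
  rw [Nat.add_comm, Function.iterate_add_apply, h, h']

theorem single {a b : α} (h : f a = some b) : RunsIn f 1 a b := head h (refl b)

/-- A simulation: if every step of `f` from `a` is matched by one step of `g` from `φ a`, then so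
is every run. -/
theorem map {β : Type*} {g : β → Option β} {φ : α → β}
    (hφ : ∀ a b, f a = some b → g (φ a) = some (φ b)) {n : ℕ} {a b : α} (h : RunsIn f n a b) :
    RunsIn g n (φ a) (φ b) := by
  induction n generalizing b with
  | zero =>
    cases Option.some.inj h
    exact refl _
  | succ n ih =>
    unfold RunsIn at h
    rw [Function.iterate_succ_apply'] at h
    cases hc : (flip bind f)^[n] (some a) with
    | none => rw [hc] at h; cases h
    | some c =>
      rw [hc] at h
      exact (ih hc).trans (single (hφ c b h))

end RunsIn

theorem initList_eq (tm : FinTM2) (s : List (tm.Γ tm.k₀)) :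
    initList tm s = ⟨some tm.main, tm.initialState, Function.update (fun _ => []) tm.k₀ s⟩ := by
  unfold initList
  congr 1
  funext k
  by_cases h : k = tm.k₀
  · subst h; simp
  · simp [h]

theorem haltList_eq (tm : FinTM2) (s : List (tm.Γ tm.k₁)) :
    haltList tm s = ⟨none, tm.initialState, Function.update (fun _ => []) tm.k₁ s⟩ := by
  unfold haltList
  congr 1
  funext k
  by_cases h : k = tm.k₁
  · subst h; simp
  · simp [h]

theorem polyEval_mono (p : Polynomial ℕ) : Monotone fun n : ℕ => p.eval n := by
  intro m n h
  simp only [Polynomial.eval_eq_sum, Polynomial.sum]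
  gcongr

/-- `f` is computed in polynomial time when its arguments and values are written by means of
`ea` and `eb`. -/
abbrev PolyTimeVia {α β A B : Type} (ea : α → List A) (eb : β → List B) (f : α → β) : Prop :=
  Nonempty (TM2ComputableInPolyTime ea eb f)

theorem PolyTimeVia.of_runs {α β A B : Type} {ea : α → List A} {eb : β → List B} {f : α → β}
    (tm : FinTM2) (ia : tm.Γ tm.k₀ ≃ A) (ib : tm.Γ tm.k₁ ≃ B) (p : Polynomial ℕ)
    (h : ∀ a, ∃ n ≤ p.eval (ea a).length,
      RunsIn tm.step n
        ⟨some tm.main, tm.initialState,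
          Function.update (fun _ => []) tm.k₀ ((ea a).map ia.symm)⟩
        ⟨none, tm.initialState,
          Function.update (fun _ => []) tm.k₁ ((eb (f a)).map ib.symm)⟩) :
    PolyTimeVia ea eb f := by
  choose n hn hr using h
  refine ⟨⟨⟨tm, ia, ib⟩, p, fun a => ⟨⟨n a, ?_⟩, hn a⟩⟩⟩
  have := hr a
  rw [← haltList_eq, ← initList_eq] at this
  exact this

theorem PolyTimeVia.exists_runs {α β A B : Type} {ea : α → List A} {eb : β → List B} {f : α → β}
    (h : PolyTimeVia ea eb f) :
    ∃ (tm : FinTM2) (ia : tm.Γ tm.k₀ ≃ A) (ib : tm.Γ tm.k₁ ≃ B) (p : Polynomial ℕ),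
    ∀ a, ∃ n ≤ p.eval (ea a).length,
      RunsIn tm.step n
        ⟨some tm.main, tm.initialState,
          Function.update (fun _ => []) tm.k₀ ((ea a).map ia.symm)⟩
        ⟨none, tm.initialState,
          Function.update (fun _ => []) tm.k₁ ((eb (f a)).map ib.symm)⟩ := by
  obtain ⟨⟨⟨tm, ia, ib⟩, p, H⟩⟩ := h
  refine ⟨tm, ia, ib, p, fun a => ⟨(H a).steps, (H a).steps_le_m, ?_⟩⟩
  rw [← haltList_eq, ← initList_eq]
  exact (H a).evals_in_steps

/-- Change of arguments, values and encodings: a machine only sees the strings. -/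
theorem PolyTimeVia.congr {α β A B α' β' : Type} {ea : α → List A} {eb : β → List B} {f : α → β}
    {ea' : α' → List A} {eb' : β' → List B} {f' : α' → β'} (h : PolyTimeVia ea eb f)
    (φ : α' → α) (ha : ∀ a, ea (φ a) = ea' a) (hb : ∀ a, eb (f (φ a)) = eb' (f' a)) :
    PolyTimeVia ea' eb' f' := by
  obtain ⟨M⟩ := h
  refine ⟨⟨M.toTM2ComputableAux, M.time, fun a => ?_⟩⟩
  rw [← ha, ← hb]
  exact M.outputsFun (φ a)

/-! ### Growth of stacks -/

section growth

variable {K : Type*} {Γ : K → Type*} {Λ σ : Type*}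

/-- The number of push instructions in a statement. -/
def pushCount : TM2.Stmt Γ Λ σ → ℕ
  | .push _ _ q => pushCount q + 1
  | .peek _ _ q => pushCount q
  | .pop _ _ q => pushCount q
  | .load _ q => pushCount q
  | .branch _ q₁ q₂ => max (pushCount q₁) (pushCount q₂)
  | .goto _ => 0
  | .halt => 0

theorem length_stepAux_le [DecidableEq K] (q : TM2.Stmt Γ Λ σ) (v : σ) (S : ∀ k, List (Γ k))
    (k : K) : ((TM2.stepAux q v S).stk k).length ≤ (S k).length + pushCount q := by
  induction q generalizing v S with
  | push j f q ih =>
    refine (ih _ _).trans ?_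
    by_cases h : k = j
    · subst h; simp [pushCount]; omega
    · simp [h, pushCount]
  | pop j f q ih =>
    refine (ih _ _).trans ?_
    by_cases h : k = j
    · subst h; simp [pushCount]
    · simp [h, pushCount]
  | peek j f q ih => exact ih _ _
  | load f q ih => exact ih _ _
  | branch f q₁ q₂ ih₁ ih₂ =>
    have h₁ := ih₁ v S
    have h₂ := ih₂ v S
    simp only [TM2.stepAux, pushCount]
    cases f v <;> simp only [cond] <;> omega
  | goto f => simp [pushCount]
  | halt => simp [pushCount]

end growth

/-- In every step a stack grows by at most a constant, the largest number of pushes in a label of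
the program. -/
theorem exists_growth (tm : FinTM2) : ∃ c : ℕ, ∀ (n : ℕ) (a b : tm.Cfg) (k : tm.K),
    RunsIn tm.step n a b → (b.stk k).length ≤ (a.stk k).length + c * n := by
  have := tm.ΛFin
  refine ⟨Finset.univ.sup fun l => pushCount (tm.m l), fun n a b k h => ?_⟩
  induction n generalizing b with
  | zero => cases Option.some.inj h; simp
  | succ n ih =>
    unfold RunsIn at h
    rw [Function.iterate_succ_apply'] at h
    cases hc : (flip bind tm.step)^[n] (some a) with
    | none => rw [hc] at h; cases h
    | some c =>
      rw [hc] at h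
      have h1 := ih c hc
      have h2 : TM2.step tm.m c = some b := h
      obtain ⟨l, v, S⟩ := c
      cases l with
      | none => cases h2
      | some l =>
        cases Option.some.inj h2
        have h3 := length_stepAux_le (tm.m l) v S k
        have h4 : pushCount (tm.m l) ≤ Finset.univ.sup fun l => pushCount (tm.m l) :=
          Finset.le_sup (f := fun l => pushCount (tm.m l)) (Finset.mem_univ l)
        rw [Nat.mul_succ]
        have h5 : (S k).length ≤ (a.stk k).length + _ := h1
        refine h3.trans ?_
        omega

/-! ### Running one machine after another -/

namespace RevComp

variable (M N : FinTM2)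

/-- The stacks of both machines. -/
abbrev Stack : M.K ⊕ N.K → Type := Sum.elim M.Γ N.Γ

/-- The labels of both machines, and those of the loop that moves the output of the first machine
to the input stack of the second: `none` pops a symbol, `some b` pushes `b`. -/
abbrev Label : Type := M.Λ ⊕ Option (N.Γ N.k₀) ⊕ N.Λ

/-- The states of both machines, and the symbol that is being moved. -/
abbrev State : Type := M.σ × N.σ × Option (N.Γ N.k₀)

variable {M N}

/-- The statements of the first machine, which goes on to the loop instead of halting. -/
def liftFst : TM2.Stmt M.Γ M.Λ M.σ → TM2.Stmt (Stack M N) (Label M N) (State M N)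
  | .push k f q => .push (Sum.inl k) (fun s => f s.1) (liftFst q)
  | .peek k f q => .peek (Sum.inl k) (fun s o => (f s.1 o, s.2)) (liftFst q)
  | .pop k f q => .pop (Sum.inl k) (fun s o => (f s.1 o, s.2)) (liftFst q)
  | .load f q => .load (fun s => (f s.1, s.2)) (liftFst q)
  | .branch f q₁ q₂ => .branch (fun s => f s.1) (liftFst q₁) (liftFst q₂)
  | .goto f => .goto fun s => Sum.inl (f s.1)
  | .halt => .goto fun _ => Sum.inr (Sum.inl none)

/-- The statements of the second machine. -/
def liftSnd : TM2.Stmt N.Γ N.Λ N.σ → TM2.Stmt (Stack M N) (Label M N) (State M N)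
  | .push k f q => .push (Sum.inr k) (fun s => f s.2.1) (liftSnd q)
  | .peek k f q => .peek (Sum.inr k) (fun s o => (s.1, f s.2.1 o, s.2.2)) (liftSnd q)
  | .pop k f q => .pop (Sum.inr k) (fun s o => (s.1, f s.2.1 o, s.2.2)) (liftSnd q)
  | .load f q => .load (fun s => (s.1, f s.2.1, s.2.2)) (liftSnd q)
  | .branch f q₁ q₂ => .branch (fun s => f s.2.1) (liftSnd q₁) (liftSnd q₂)
  | .goto f => .goto fun s => Sum.inr (Sum.inr (f s.2.1))
  | .halt => .halt

/-- The program of the composed machine; `φ` translates the output alphabet of the first machine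
to the input alphabet of the second. -/
def code (φ : M.Γ M.k₁ → N.Γ N.k₀) :
    Label M N → TM2.Stmt (Stack M N) (Label M N) (State M N)
  | .inl l => liftFst (M.m l)
  | .inr (.inl none) =>
    .pop (Sum.inl M.k₁) (fun s o => (s.1, s.2.1, o.map φ)) <|
      .goto fun s => match s.2.2 with
        | none => Sum.inr (Sum.inr N.main)
        | some b => Sum.inr (Sum.inl (some b))
  | .inr (.inl (some b)) =>
    .push (Sum.inr N.k₀) (fun _ => b) (.goto fun _ => Sum.inr (Sum.inl none))
  | .inr (.inr l) => liftSnd (N.m l)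

/-- The machine that runs `M`, moves the output of `M` to the input stack of `N`, which reverses
it, and then runs `N`. -/
def machine (φ : M.Γ M.k₁ → N.Γ N.k₀) : FinTM2 :=
  haveI := M.ΛFin
  haveI := N.ΛFin
  haveI := M.σFin
  haveI := N.σFin
  haveI := M.kFin
  haveI := N.kFin
  haveI := M.Γk₀Fin
  haveI := N.Γk₀Fin
  { K := M.K ⊕ N.K
    k₀ := Sum.inl M.k₀
    k₁ := Sum.inr N.k₁
    Γ := Stack M N
    Λ := Label M N
    main := Sum.inl M.main
    σ := State M N
    initialState := (M.initialState, N.initialState, none)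
    Γk₀Fin := M.Γk₀Fin
    m := code φ }

/-- The stacks of both machines as one family. -/
def bothStacks (S : ∀ k, List (M.Γ k)) (T : ∀ k, List (N.Γ k)) : ∀ k, List (Stack M N k)
  | .inl k => S k
  | .inr k => T k

theorem update_bothStacks_inl (S : ∀ k, List (M.Γ k)) (T : ∀ k, List (N.Γ k)) (k : M.K)
    (l : List (M.Γ k)) :
    Function.update (β := fun j => List (Stack M N j)) (bothStacks S T) (Sum.inl k) l =
      bothStacks (Function.update S k l) T := by
  funext j
  rcases j with j | j
  · by_cases h : j = k
    · subst h
      refine (Function.update_self _ _ _).trans ?_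
      simp [bothStacks]
    · exact (Function.update_of_ne (by simpa using h) _ _).trans
        (Function.update_of_ne h _ _).symm
  · exact Function.update_of_ne (by simp) _ _

theorem update_bothStacks_inr (S : ∀ k, List (M.Γ k)) (T : ∀ k, List (N.Γ k)) (k : N.K)
    (l : List (N.Γ k)) :
    Function.update (β := fun j => List (Stack M N j)) (bothStacks S T) (Sum.inr k) l =
      bothStacks S (Function.update T k l) := by
  funext j
  rcases j with j | j
  · exact Function.update_of_ne (by simp) _ _
  · by_cases h : j = k
    · subst h
      refine (Function.update_self _ _ _).trans ?_
      simp [bothStacks]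
    · exact (Function.update_of_ne (by simpa using h) _ _).trans
        (Function.update_of_ne h _ _).symm

/-- A configuration of the first machine, next to a fixed one of the second. -/
def embedFst (t : N.σ) (T : ∀ k, List (N.Γ k)) (c : TM2.Cfg M.Γ M.Λ M.σ) :
    TM2.Cfg (Stack M N) (Label M N) (State M N) :=
  ⟨some (c.l.elim (Sum.inr (Sum.inl none)) Sum.inl), (c.var, t, none), bothStacks c.stk T⟩

/-- A configuration of the second machine, next to a fixed one of the first. -/
def embedSnd (s : M.σ) (S : ∀ k, List (M.Γ k)) (c : TM2.Cfg N.Γ N.Λ N.σ) :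
    TM2.Cfg (Stack M N) (Label M N) (State M N) :=
  ⟨c.l.map fun l => Sum.inr (Sum.inr l), (s, c.var, none), bothStacks S c.stk⟩

theorem stepAux_liftFst (q : TM2.Stmt M.Γ M.Λ M.σ) (v : M.σ) (S : ∀ k, List (M.Γ k))
    (t : N.σ) (T : ∀ k, List (N.Γ k)) :
    TM2.stepAux (liftFst q) (v, t, none) (bothStacks S T) = embedFst t T (TM2.stepAux q v S) := by
  induction q generalizing v S with
  | push k f q ih =>
    simp only [liftFst, TM2.stepAux, ← ih]
    exact congrArg _ (update_bothStacks_inl _ _ _ _)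
  | peek k f q ih => simp only [liftFst, TM2.stepAux, ← ih]; rfl
  | pop k f q ih =>
    simp only [liftFst, TM2.stepAux, ← ih]
    exact congrArg _ (update_bothStacks_inl _ _ _ _)
  | load f q ih => simp only [liftFst, TM2.stepAux, ← ih]
  | branch f q₁ q₂ ih₁ ih₂ =>
    simp only [liftFst, TM2.stepAux]
    cases f v
    · exact ih₂ _ _
    · exact ih₁ _ _
  | goto f => rfl
  | halt => rfl

theorem stepAux_liftSnd (q : TM2.Stmt N.Γ N.Λ N.σ) (v : N.σ) (S : ∀ k, List (N.Γ k))
    (t : M.σ) (T : ∀ k, List (M.Γ k)) :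
    TM2.stepAux (liftSnd q) (t, v, none) (bothStacks T S) = embedSnd t T (TM2.stepAux q v S) := by
  induction q generalizing v S with
  | push k f q ih =>
    simp only [liftSnd, TM2.stepAux, ← ih]
    exact congrArg _ (update_bothStacks_inr _ _ _ _)
  | peek k f q ih => simp only [liftSnd, TM2.stepAux, ← ih]; rfl
  | pop k f q ih =>
    simp only [liftSnd, TM2.stepAux, ← ih]
    exact congrArg _ (update_bothStacks_inr _ _ _ _)
  | load f q ih => simp only [liftSnd, TM2.stepAux, ← ih]
  | branch f q₁ q₂ ih₁ ih₂ =>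
    simp only [liftSnd, TM2.stepAux]
    cases f v
    · exact ih₂ _ _
    · exact ih₁ _ _
  | goto f => rfl
  | halt => rfl

theorem runs_fst (φ : M.Γ M.k₁ → N.Γ N.k₀) (t : N.σ) (T : ∀ k, List (N.Γ k)) {n : ℕ}
    {a b : M.Cfg} (h : RunsIn M.step n a b) :
    RunsIn (TM2.step (code φ)) n (embedFst t T a) (embedFst t T b) := by
  refine RunsIn.map (φ := embedFst t T) ?_ h
  rintro ⟨_ | l, v, S⟩ b h
  · cases h
  · cases Option.some.inj h
    exact congrArg some (stepAux_liftFst (M.m l) v S t T)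

theorem runs_snd (φ : M.Γ M.k₁ → N.Γ N.k₀) (t : M.σ) (T : ∀ k, List (M.Γ k)) {n : ℕ}
    {a b : N.Cfg} (h : RunsIn N.step n a b) :
    RunsIn (TM2.step (code φ)) n (embedSnd t T a) (embedSnd t T b) := by
  refine RunsIn.map (φ := embedSnd t T) ?_ h
  rintro ⟨_ | l, v, S⟩ b h
  · cases h
  · cases Option.some.inj h
    exact congrArg some (stepAux_liftSnd (N.m l) v S t T)

/-- The loop that moves the output of the first machine to the input stack of the second. -/
theorem runs_move (φ : M.Γ M.k₁ → N.Γ N.k₀) (s : List (M.Γ M.k₁)) (t : List (N.Γ N.k₀))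
    (u : Option (N.Γ N.k₀)) :
    RunsIn (TM2.step (code φ)) (2 * s.length + 1)
      ⟨some (Sum.inr (Sum.inl none)), (M.initialState, N.initialState, u),
        bothStacks (Function.update (fun _ => []) M.k₁ s) (Function.update (fun _ => []) N.k₀ t)⟩
      ⟨some (Sum.inr (Sum.inr N.main)), (M.initialState, N.initialState, none),
        bothStacks (fun _ => [])
          (Function.update (fun _ => []) N.k₀ ((s.map φ).reverse ++ t))⟩ := by
  induction s generalizing t u with
  | nil =>
    refine RunsIn.single (congrArg some ?_)
    simp only [code, TM2.stepAux]
    refine (congrArg (TM2.Cfg.mk _ _) (update_bothStacks_inl _ _ _ _)).trans ?_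
    simp [bothStacks]
  | cons a s ih =>
    have h2 := ih (φ a :: t) (some (φ a))
    have e : 2 * (a :: s).length + 1 = 2 * s.length + 1 + 1 + 1 := by simp; ring
    rw [e]
    refine RunsIn.head (b := ⟨some (Sum.inr (Sum.inl (some (φ a)))),
        (M.initialState, N.initialState, some (φ a)),
        bothStacks (Function.update (fun _ => []) M.k₁ s)
          (Function.update (fun _ => []) N.k₀ t)⟩) ?_ (RunsIn.head ?_ (by simpa using h2))
    · refine congrArg some ?_
      simp only [code, TM2.stepAux]
      refine (congrArg (TM2.Cfg.mk _ _) (update_bothStacks_inl _ _ _ _)).trans ?_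
      simp [bothStacks]
    · refine congrArg some ?_
      simp only [code, TM2.stepAux]
      refine (congrArg (TM2.Cfg.mk _ _) (update_bothStacks_inr _ _ _ _)).trans ?_
      simp [bothStacks]

end RevComp

/-- Composition, where the second machine receives the output of the first in reverse order. -/
theorem PolyTimeVia.comp_reverse {α β γ A B C : Type} {ea : α → List A} {eb : β → List B}
    {eb' : β → List B} {ec : γ → List C} {f : α → β} {g : β → γ}
    (hg : PolyTimeVia eb' ec g) (hf : PolyTimeVia ea eb f)
    (h : ∀ a, eb' (f a) = (eb (f a)).reverse) : PolyTimeVia ea ec (g ∘ f) := by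
  obtain ⟨M, ia, ib, p, hM⟩ := hf.exists_runs
  obtain ⟨N, jb, jc, q, hN⟩ := hg.exists_runs
  obtain ⟨c, hc⟩ := exists_growth M
  let φ : M.Γ M.k₁ → N.Γ N.k₀ := fun s => jb.symm (ib s)
  -- the length of the output of `M` is at most `r`
  let r : Polynomial ℕ := Polynomial.X + Polynomial.C c * p
  refine PolyTimeVia.of_runs (RevComp.machine φ) ia jc (p + (2 * r + 1) + q.comp r) fun a => ?_
  obtain ⟨m, hm, hr⟩ := hM a
  obtain ⟨n, hn, hs⟩ := hN (f a)
  have hlen : (eb (f a)).length ≤ r.eval (ea a).length := by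
    have h1 := hc _ _ _ M.k₁ hr
    simp only [Function.update_self, List.length_map] at h1
    have h2 : (Function.update (β := fun k => List (M.Γ k)) (fun _ => []) M.k₀
        ((ea a).map ia.symm) M.k₁).length ≤ (ea a).length := by
      by_cases e : M.k₁ = M.k₀
      · rw [e]; simp
      · simp [e]
    have h3 : c * m ≤ c * p.eval (ea a).length := Nat.mul_le_mul_left _ hm
    simp only [r, Polynomial.eval_add, Polynomial.eval_X, Polynomial.eval_mul, Polynomial.eval_C]
    omega
  refine ⟨m + (2 * (eb (f a)).length + 1) + n, ?_, ?_⟩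
  · have h1 : n ≤ q.eval (r.eval (ea a).length) := by
      refine hn.trans (polyEval_mono q ?_)
      rw [h, List.length_reverse]
      exact hlen
    simp only [Polynomial.eval_add, Polynomial.eval_mul, Polynomial.eval_one,
      Polynomial.eval_ofNat, Polynomial.eval_comp]
    omega
  · have h1 := RevComp.runs_fst φ N.initialState (fun _ => []) hr
    have h2 := RevComp.runs_move φ ((eb (f a)).map ib.symm) [] none
    have h3 := RevComp.runs_snd φ M.initialState (fun _ => []) hs
    have e : (((eb (f a)).map ib.symm).map φ).reverse ++ [] = (eb' (f a)).map jb.symm := by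
      simp [h, φ, Function.comp_def]
    rw [List.length_map, e] at h2
    have h2' : RunsIn (TM2.step (RevComp.code φ)) (2 * (eb (f a)).length + 1)
        (RevComp.embedFst N.initialState (fun _ => [])
          ⟨none, M.initialState, Function.update (fun _ => []) M.k₁ ((eb (f a)).map ib.symm)⟩)
        (RevComp.embedSnd M.initialState (fun _ => [])
          ⟨some N.main, N.initialState,
            Function.update (fun _ => []) N.k₀ ((eb' (f a)).map jb.symm)⟩) := by
      have e' : Function.update (β := fun k => List (N.Γ k)) (fun _ => []) N.k₀ [] =
          fun _ => [] := Function.update_eq_self _ _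
      rw [e'] at h2
      exact h2
    have h4 := (h1.trans h2').trans h3
    have e₁ : (⟨some (Sum.inl M.main), (M.initialState, N.initialState, none),
        Function.update (fun _ => []) (Sum.inl M.k₀) ((ea a).map ia.symm)⟩ :
          TM2.Cfg (RevComp.Stack M N) (RevComp.Label M N) (RevComp.State M N)) =
        RevComp.embedFst N.initialState (fun _ => [])
          ⟨some M.main, M.initialState,
            Function.update (fun _ => []) M.k₀ ((ea a).map ia.symm)⟩ := by
      refine congrArg (TM2.Cfg.mk _ _) ?_
      exact (congrArg (fun S => Function.update (β := fun j => List (RevComp.Stack M N j)) S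
        (Sum.inl M.k₀) ((ea a).map ia.symm)) (by funext j; cases j <;> rfl)).trans
        (RevComp.update_bothStacks_inl (fun _ => []) (fun _ => []) M.k₀ ((ea a).map ia.symm))
    have e₂ : (⟨none, (M.initialState, N.initialState, none),
        Function.update (fun _ => []) (Sum.inr N.k₁) ((ec (g (f a))).map jc.symm)⟩ :
          TM2.Cfg (RevComp.Stack M N) (RevComp.Label M N) (RevComp.State M N)) =
        RevComp.embedSnd M.initialState (fun _ => [])
          ⟨none, N.initialState,
            Function.update (fun _ => []) N.k₁ ((ec (g (f a))).map jc.symm)⟩ := by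
      refine congrArg (TM2.Cfg.mk _ _) ?_
      exact (congrArg (fun S => Function.update (β := fun j => List (RevComp.Stack M N j)) S
        (Sum.inr N.k₁) ((ec (g (f a))).map jc.symm)) (by funext j; cases j <;> rfl)).trans
        (RevComp.update_bothStacks_inr (fun _ => []) (fun _ => []) N.k₁
          ((ec (g (f a))).map jc.symm))
    rw [← e₁, ← e₂] at h4
    exact h4

/-- Composition of functions that are computable in polynomial time. -/
theorem PolyTimeVia.comp {α β γ A B C : Type} [Fintype B] {ea : α → List A} {eb : β → List B}
    {ec : γ → List C} {f : α → β} {g : β → γ}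
    (hg : PolyTimeVia eb ec g) (hf : PolyTimeVia ea eb f) : PolyTimeVia ea ec (g ∘ f) := by
  -- reversing twice changes nothing
  have h : PolyTimeVia ea (fun b => (eb b).reverse) f :=
    (PolyTimeVia.comp_reverse (eb' := fun b => (eb b).reverse)
      ⟨idComputableInPolyTime fun b => (eb b).reverse⟩ hf fun _ => rfl)
  exact PolyTimeVia.comp_reverse hg h fun a => by simp

theorem polyTime_reverse {A : Type} [Fintype A] : PolyTime (List.reverse : List A → List A) :=
  (PolyTimeVia.comp_reverse (ea := (id : List A → List A)) (eb' := List.reverse)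
      ⟨idComputableInPolyTime List.reverse⟩ ⟨idComputableInPolyTime id⟩ fun _ => rfl).congr
      id (fun _ => rfl) fun _ => rfl

/-- A step of a machine, checked componentwise. -/
theorem step_eq {K : Type} [DecidableEq K] {Γ : K → Type} {Λ σ : Type}
    {M : Λ → TM2.Stmt Γ Λ σ} {l : Λ} {v : σ} {S : ∀ k, List (Γ k)} {c : TM2.Cfg Γ Λ σ}
    (hl : (TM2.stepAux (M l) v S).l = c.l) (hv : (TM2.stepAux (M l) v S).var = c.var)
    (hs : ∀ k, (TM2.stepAux (M l) v S).stk k = c.stk k) :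
    TM2.step M ⟨some l, v, S⟩ = some c := by
  obtain ⟨l', v', S'⟩ := c
  refine congrArg some ?_
  revert hl hv hs
  generalize TM2.stepAux (M l) v S = d
  obtain ⟨l₂, v₂, S₂⟩ := d
  rintro rfl rfl hs
  obtain rfl := funext hs
  rfl

/-! ### Finite-state transducers -/

/-- The output of a finite-state transducer started in the state `q`: reading `a` in the state `q`,
it writes `out q a` and goes to the state `δ q a`; at the end of its input it writes `fin q`. -/
def transduce {Q A B : Type} (δ : Q → A → Q) (out : Q → A → List B) (fin : Q → List B) :
    Q → List A → List B
  | q, [] => fin q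
  | q, a :: l => out q a ++ transduce δ out fin (δ q a) l

section pushWord

variable {K : Type} [DecidableEq K] {Γ : K → Type} {Λ σ : Type}

/-- Push the letters of a word, one by one. -/
def pushWord (k : K) : List (Γ k) → TM2.Stmt Γ Λ σ → TM2.Stmt Γ Λ σ
  | [], s => s
  | b :: w, s => .push k (fun _ => b) (pushWord k w s)

theorem stepAux_pushWord (k : K) (w : List (Γ k)) (s : TM2.Stmt Γ Λ σ) (v : σ)
    (S : ∀ k, List (Γ k)) :
    TM2.stepAux (pushWord k w s) v S =
      TM2.stepAux s v (Function.update S k (w.reverse ++ S k)) := by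
  induction w generalizing S with
  | nil => simp [pushWord]
  | cons b w ih => simp [pushWord, ih]

end pushWord

namespace Transducer

variable {Q A B : Type} (δ : Q → A → Q) (out : Q → A → List B) (fin : Q → List B) (q₀ : Q)

/-- The input stack `true` and the output stack `false`. -/
abbrev Stack (A B : Type) : Bool → Type
  | true => A
  | false => B

/-- The label `none` reads a symbol, `some q` writes what the transducer writes in the state `q`
for the symbol that was read. -/
def code : Option (Q × Option A) → TM2.Stmt (Stack A B) (Option (Q × Option A)) (Q × Option A)
  | none => .pop true (fun s o => (s.1, o)) (.goto fun s => some s)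
  | some (q, some a) =>
    pushWord (Γ := Stack A B) false (out q a) (.load (fun _ => (δ q a, none)) (.goto fun _ => none))
  | some (q, none) => pushWord (Γ := Stack A B) false (fin q) (.load (fun _ => (q₀, none)) .halt)

/-- The contents of both stacks. -/
def stk (l : List A) (w : List B) : ∀ k, List (Stack A B k)
  | true => l
  | false => w

theorem runs (q : Q) (l : List A) (w : List B) :
    RunsIn (TM2.step (code δ out fin q₀)) (2 * l.length + 2)
      ⟨some none, (q, none), stk l w⟩
      ⟨none, (q₀, none), stk [] ((transduce δ out fin q l).reverse ++ w)⟩ := by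
  induction l generalizing q w with
  | nil =>
    refine RunsIn.head (n := 1) (b := ⟨some (some (q, none)), (q, none), stk [] w⟩)
      (step_eq rfl rfl fun k => by cases k <;> rfl)
      (RunsIn.single (step_eq ?_ ?_ fun k => ?_))
    all_goals simp only [code, stepAux_pushWord]
    · rfl
    · rfl
    · cases k <;> rfl
  | cons a l ih =>
    refine RunsIn.head (n := 2 * l.length + 2 + 1)
      (b := ⟨some (some (q, some a)), (q, some a), stk l w⟩)
      (step_eq rfl rfl fun k => by cases k <;> rfl)
      (RunsIn.head (b := ⟨some none, (δ q a, none), stk l ((out q a).reverse ++ w)⟩)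
        (step_eq ?_ ?_ fun k => ?_) ?_)
    · simp only [code, stepAux_pushWord]; rfl
    · simp only [code, stepAux_pushWord]; rfl
    · simp only [code, stepAux_pushWord]
      cases k <;> rfl
    · simpa [transduce] using ih (δ q a) ((out q a).reverse ++ w)

end Transducer

theorem polyTime_transduce {Q A B : Type} [Fintype Q] [Fintype A] [Fintype B] (δ : Q → A → Q)
    (out : Q → A → List B) (fin : Q → List B) (q₀ : Q) :
    PolyTime (transduce δ out fin q₀) := by
  -- the machine pushes its output, which leaves it in reverse order
  have h : PolyTime fun l => (transduce δ out fin q₀ l).reverse := by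
    let tm : FinTM2 :=
      { K := Bool
        k₀ := true
        k₁ := false
        Γ := Transducer.Stack A B
        Λ := Option (Q × Option A)
        main := none
        σ := Q × Option A
        initialState := (q₀, none)
        Γk₀Fin := inferInstanceAs (Fintype A)
        m := Transducer.code δ out fin q₀ }
    refine PolyTimeVia.of_runs tm (Equiv.refl A) (Equiv.refl B) (2 * Polynomial.X + 2)
      fun l => ⟨2 * l.length + 2, by simp, ?_⟩
    have h := Transducer.runs δ out fin q₀ q₀ l []
    have e₁ : Function.update (β := fun k => List (Transducer.Stack A B k)) (fun _ => []) true l =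
        Transducer.stk l [] := by funext k; cases k <;> rfl
    have e₂ (w : List B) : Function.update (β := fun k => List (Transducer.Stack A B k))
        (fun _ => []) false w = Transducer.stk [] w := by funext k; cases k <;> rfl
    rw [← e₁, ← e₂, List.append_nil] at h
    have e₃ : l.map (Equiv.refl A).symm = l := List.map_id l
    have e₄ (w : List B) : w.map (Equiv.refl B).symm = w := List.map_id w
    rw [e₄, id, e₃]
    exact h
  exact (PolyTimeVia.comp polyTime_reverse h).congr id (fun _ => rfl) fun l => by simp

theorem polyTime_flatMap {A B : Type} [Fintype A] [Fintype B] (f : A → List B) :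
    PolyTime (List.flatMap f) := by
  have h : transduce (fun (_ : Unit) _ => ()) (fun _ a => f a) (fun _ => []) () =
      List.flatMap f := by
    funext l
    induction l with
    | nil => rfl
    | cons a l ih => simp [transduce, ih]
  rw [← h]
  exact polyTime_transduce _ _ _ _

theorem polyTime_map {A B : Type} [Fintype A] [Fintype B] (f : A → B) :
    PolyTime (List.map f) := by
  have h := polyTime_flatMap fun a => [f a]
  rwa [show List.flatMap (fun a => [f a]) = List.map f from
    funext fun l => (List.map_eq_flatMap (f := f) (l := l)).symm] at h

theorem polyTime_filterMap {A B : Type} [Fintype A] [Fintype B] (f : A → Option B) :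
    PolyTime (List.filterMap f) := by
  have h := polyTime_flatMap fun a => (f a).toList
  rwa [show List.flatMap (fun a => (f a).toList) = List.filterMap f from
    funext fun l => (List.filterMap_eq_flatMap_toList f l).symm] at h

theorem polyTime_append_const {A : Type} [Fintype A] (w : List A) :
    PolyTime fun l => l ++ w := by
  have h : transduce (fun (_ : Unit) _ => ()) (fun _ a => [a]) (fun _ => w) () =
      fun l => l ++ w := by
    funext l
    induction l with
    | nil => rfl
    | cons a l ih => simp [transduce, ih]
  rw [← h]
  exact polyTime_transduce _ _ _ _

theorem polyTime_const_append {A : Type} [Fintype A] (w : List A) :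
    PolyTime fun l => w ++ l :=
  (PolyTimeVia.comp polyTime_reverse
    (PolyTimeVia.comp (polyTime_append_const w.reverse) polyTime_reverse)).congr id
      (fun _ => rfl) fun l => by simp

theorem polyTime_const {A B : Type} [Fintype A] [Fintype B] (w : List B) :
    PolyTime fun _ : List A => w := by
  have h : transduce (fun (_ : Unit) (_ : A) => ()) (fun _ _ => []) (fun _ => w) () =
      fun _ => w := by
    funext l
    induction l with
    | nil => rfl
    | cons a l ih => simp [transduce, ih]
  rw [← h]
  exact polyTime_transduce _ _ _ _

/-- Every letter is replaced by a word that may depend on the final state of a finite automaton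
run on the whole list: one pass writes that state behind the list, and a second pass, from right
to left, makes use of it. -/
theorem polyTime_flatMap_foldl {Q A B : Type} [Fintype Q] [Fintype A] [Fintype B]
    (δ : Q → A → Q) (q₀ : Q) (f : Q → A → List B) (fin : Q → List B) :
    PolyTime fun l : List A =>
      l.flatMap (f (l.foldl δ q₀)) ++ fin (l.foldl δ q₀) := by
  let T₁ : List A → List (A ⊕ Q) :=
    transduce δ (fun _ a => [Sum.inl a]) (fun q => [Sum.inr q]) q₀
  have h₁ : ∀ l, T₁ l = l.map Sum.inl ++ [Sum.inr (l.foldl δ q₀)] := by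
    intro l
    simp only [T₁]
    generalize q₀ = q
    induction l generalizing q with
    | nil => rfl
    | cons a l ih => simp [transduce, ih]
  let T₂ : List (A ⊕ Q) → List B :=
    transduce (fun (s : Option Q) x => x.elim (fun _ => s) some)
      (fun s x => x.elim (fun a => s.elim [] fun q => (f q a).reverse) fun q => (fin q).reverse)
      (fun _ => []) none
  have h₂ : ∀ q (l : List A), transduce (fun (s : Option Q) x => x.elim (fun _ => s) some)
      (fun s x => x.elim (fun a => s.elim [] fun q => (f q a).reverse) fun q => (fin q).reverse)
      (fun _ => []) (some q) (l.map Sum.inl) = l.flatMap fun a => (f q a).reverse := by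
    intro q l
    induction l with
    | nil => rfl
    | cons a l ih => simp [transduce, ih]
  have h₃ : ∀ l, (T₂ (T₁ l).reverse).reverse =
      l.flatMap (f (l.foldl δ q₀)) ++ fin (l.foldl δ q₀) := by
    intro l
    have e : (T₁ l).reverse = Sum.inr (l.foldl δ q₀) :: l.reverse.map Sum.inl := by simp [h₁]
    rw [e]
    simp only [T₂, transduce, Sum.elim_inr]
    rw [h₂]
    simp [List.reverse_flatMap, Function.comp_def]
  exact (PolyTimeVia.comp polyTime_reverse
    (PolyTimeVia.comp (polyTime_transduce _ _ _ _ : PolyTime T₂)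
      (PolyTimeVia.comp polyTime_reverse (polyTime_transduce _ _ _ _ : PolyTime T₁)))).congr id
      (fun _ => rfl) h₃

/-! ### The product of a list with itself -/

namespace Square

variable {A : Type}

/-- The stacks of the machine: the input, two copies of its reverse, an auxiliary stack, and the
output. -/
inductive StackName
  | input
  | fst
  | snd
  | aux
  | output
  deriving DecidableEq

instance : Fintype StackName :=
  ⟨{.input, .fst, .snd, .aux, .output}, fun k => by cases k <;> simp⟩

/-- The alphabets of the stacks. -/
abbrev Stack (A : Type) : StackName → Type
  | .output => A × A
  | _ => A

/-- The labels of the machine: copy the input; take the next letter as first component; run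
through the second components; put these back. -/
inductive Label
  | copy
  | next
  | pair
  | restore
  deriving DecidableEq

instance : Fintype Label :=
  ⟨{.copy, .next, .pair, .restore}, fun k => by cases k <;> simp⟩

/-- The program of the machine. The state holds the current first component and the letter read
last. The branches that would need a letter where there is none are never reached and halt. -/
def code [Inhabited A] : Label → TM2.Stmt (Stack A) Label (Option A × Option A)
  | .copy => .pop .input (fun _ o => (none, o)) <|
      .branch (fun s => s.2.isSome)
        (.push .fst (fun s => s.2.getD default) <| .push .snd (fun s => s.2.getD default) <|
          .load (fun _ => (none, none)) <| .goto fun _ => .copy)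
        (.goto fun _ => .next)
  | .next => .pop .fst (fun _ o => (o, none)) <|
      .branch (fun s => s.1.isSome) (.goto fun _ => .pair)
        (.pop .snd (fun _ o => (none, o)) <|
          .branch (fun s => s.2.isSome) (.load (fun _ => (none, none)) <| .goto fun _ => .next)
            .halt)
  | .pair => .pop .snd (fun s o => (s.1, o)) <|
      .branch (fun s => s.2.isSome)
        (.push .output (fun s => (s.1.getD default, s.2.getD default)) <|
          .push .aux (fun s => s.2.getD default) <| .load (fun s => (s.1, none)) <|
          .goto fun _ => .pair)
        (.goto fun _ => .restore)
  | .restore => .pop .aux (fun _ o => (none, o)) <|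
      .branch (fun s => s.2.isSome)
        (.push .snd (fun s => s.2.getD default) <| .load (fun _ => (none, none)) <|
          .goto fun _ => .restore)
        (.goto fun _ => .next)

/-- The contents of the stacks. -/
def stk (i f s x : List A) (o : List (A × A)) : ∀ k, List (Stack A k)
  | .input => i
  | .fst => f
  | .snd => s
  | .aux => x
  | .output => o

variable [Inhabited A]

theorem runs_copy (l f s : List A) :
    RunsIn (TM2.step code) (l.length + 1)
      ⟨some .copy, (none, none), stk l f s [] []⟩
      ⟨some .next, (none, none), stk [] (l.reverse ++ f) (l.reverse ++ s) [] []⟩ := by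
  induction l generalizing f s with
  | nil => exact RunsIn.single (step_eq rfl rfl fun k => by cases k <;> rfl)
  | cons a l ih =>
    exact RunsIn.head (b := ⟨some .copy, (none, none), stk l (a :: f) (a :: s) [] []⟩)
      (step_eq rfl rfl fun k => by cases k <;> rfl) (by simpa using ih (a :: f) (a :: s))

theorem runs_pair (a : A) (f s x : List A) (o : List (A × A)) :
    RunsIn (TM2.step code) (s.length + 1)
      ⟨some .pair, (some a, none), stk [] f s x o⟩
      ⟨some .restore, (some a, none),
        stk [] f [] (s.reverse ++ x) ((s.map fun b => (a, b)).reverse ++ o)⟩ := by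
  induction s generalizing x o with
  | nil => exact RunsIn.single (step_eq rfl rfl fun k => by cases k <;> rfl)
  | cons b s ih =>
    exact RunsIn.head (b := ⟨some .pair, (some a, none), stk [] f s (b :: x) ((a, b) :: o)⟩)
      (step_eq rfl rfl fun k => by cases k <;> rfl) (by simpa using ih (b :: x) ((a, b) :: o))

theorem runs_restore (u : Option A) (f s x : List A) (o : List (A × A)) :
    RunsIn (TM2.step code) (x.length + 1)
      ⟨some .restore, (u, none), stk [] f s x o⟩
      ⟨some .next, (none, none), stk [] f (x.reverse ++ s) [] o⟩ := by
  induction x generalizing u s with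
  | nil => exact RunsIn.single (step_eq rfl rfl fun k => by cases k <;> rfl)
  | cons b x ih =>
    exact RunsIn.head (b := ⟨some .restore, (none, none), stk [] f (b :: s) x o⟩)
      (step_eq rfl rfl fun k => by cases k <;> rfl) (by simpa using ih none (b :: s))

theorem runs_clear (s : List A) (o : List (A × A)) :
    RunsIn (TM2.step code) (s.length + 1)
      ⟨some .next, (none, none), stk [] [] s [] o⟩ ⟨none, (none, none), stk [] [] [] [] o⟩ := by
  induction s with
  | nil => exact RunsIn.single (step_eq rfl rfl fun k => by cases k <;> rfl)
  | cons b s ih =>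
    exact RunsIn.head (b := ⟨some .next, (none, none), stk [] [] s [] o⟩)
      (step_eq rfl rfl fun k => by cases k <;> rfl) ih

theorem runs_next (f s : List A) (o : List (A × A)) :
    RunsIn (TM2.step code) (f.length * (2 * s.length + 3) + (s.length + 1))
      ⟨some .next, (none, none), stk [] f s [] o⟩
      ⟨none, (none, none), stk [] [] [] [] ((f ×ˢ s).reverse ++ o)⟩ := by
  induction f generalizing o with
  | nil => simpa using runs_clear s o
  | cons a f ih =>
    have e : (a :: f).length * (2 * s.length + 3) + (s.length + 1) =
        (s.length + 1) +
          ((s.length + 1) + (f.length * (2 * s.length + 3) + (s.length + 1))) + 1 := by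
      simp only [List.length_cons]; ring
    rw [e]
    refine RunsIn.head (b := ⟨some .pair, (some a, none), stk [] f s [] o⟩)
      (step_eq rfl rfl fun k => by cases k <;> rfl) ((runs_pair a f s [] o).trans ?_)
    have h₁ := runs_restore (some a) f [] s.reverse ((s.map fun b => (a, b)).reverse ++ o)
    have h₂ := ih ((s.map fun b => (a, b)).reverse ++ o)
    simp only [List.length_reverse, List.reverse_reverse, List.append_nil] at h₁
    simpa using h₁.trans h₂

end Square

theorem polyTime_product_self {A : Type} [Fintype A] :
    PolyTime fun l : List A => l ×ˢ l := by
  rcases isEmpty_or_nonempty A with hA | ⟨⟨a₀⟩⟩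
  · exact PolyTimeVia.congr (polyTime_const ([] : List (A × A))) id (fun _ => rfl) fun l => by
      cases l with
      | nil => rfl
      | cons a l => exact hA.elim a
  have : Inhabited A := ⟨a₀⟩
  let tm : FinTM2 :=
    { K := Square.StackName
      k₀ := .input
      k₁ := .output
      Γ := Square.Stack A
      Λ := Square.Label
      main := .copy
      σ := Option A × Option A
      initialState := (none, none)
      Γk₀Fin := inferInstanceAs (Fintype A)
      m := Square.code }
  refine PolyTimeVia.of_runs tm (Equiv.refl A) (Equiv.refl (A × A))
    ((Polynomial.X + 1) + (Polynomial.X * (2 * Polynomial.X + 3) + (Polynomial.X + 1)))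
    fun l => ⟨(l.length + 1) + (l.length * (2 * l.length + 3) + (l.length + 1)), by simp, ?_⟩
  have h₁ := Square.runs_copy l [] []
  have h₂ := Square.runs_next l.reverse l.reverse []
  have e₁ : Function.update (β := fun k => List (Square.Stack A k)) (fun _ => []) .input l =
      Square.stk l [] [] [] [] := by funext k; cases k <;> rfl
  have e₂ (w : List (A × A)) : Function.update (β := fun k => List (Square.Stack A k))
      (fun _ => []) .output w = Square.stk [] [] [] [] w := by funext k; cases k <;> rfl
  -- the machine turns both factors around, and the order in which it writes the pairs
  have e : (l.reverse ×ˢ l.reverse).reverse = l ×ˢ l := by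
    simp [SProd.sprod, List.product, List.reverse_flatMap, Function.comp_def, ← List.map_reverse]
  simp only [List.append_nil, e, List.length_reverse] at h₁ h₂
  have h := h₁.trans h₂
  rw [← e₁, ← e₂] at h
  have e₃ : l.map (Equiv.refl A).symm = l := List.map_id l
  have e₄ (w : List (A × A)) : w.map (Equiv.refl (A × A)).symm = w := List.map_id w
  rw [e₄, id, e₃]
  exact h

/-! ### Reading several lists in parallel -/

section columns

variable {F B : Type} [Fintype F]

/-- The columns of the table whose rows are the lists `s f`. -/
def columns (s : F → List B) : List (F → Option B) :=
  (List.range (Finset.univ.sup fun f => (s f).length)).map fun i f => (s f)[i]?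

theorem columns_eq_nil {s : F → List B} (h : ∀ f, s f = []) : columns s = [] := by
  simp [columns, h]

/-- The first column consists of the heads, and the others are the columns of the tails. -/
theorem columns_eq_cons {s : F → List B} {f₀ : F} (h : s f₀ ≠ []) :
    columns s = (fun f => (s f).head?) :: columns fun f => (s f).tail := by
  have e : (Finset.univ.sup fun f => (s f).length) =
      (Finset.univ.sup fun f => (s f).tail.length) + 1 := by
    apply le_antisymm
    · refine Finset.sup_le fun f _ => ?_
      have := Finset.le_sup (f := fun f => (s f).tail.length) (Finset.mem_univ f)
      simp only [List.length_tail] at this ⊢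
      omega
    · obtain ⟨f₁, h₁⟩ : ∃ f₁, (Finset.univ.sup fun f => (s f).tail.length) + 1 ≤ (s f₁).length := by
        obtain ⟨f₁, -, h₁⟩ := Finset.exists_mem_eq_sup Finset.univ ⟨f₀, Finset.mem_univ _⟩
          fun f => (s f).tail.length
        rw [h₁]
        rcases Nat.eq_zero_or_pos (s f₁).tail.length with h₂ | h₂
        · exact ⟨f₀, by rw [h₂]; exact List.length_pos_iff.2 h⟩
        · exact ⟨f₁, by simp at h₂ ⊢; omega⟩
      exact h₁.trans (Finset.le_sup (f := fun f => (s f).length) (Finset.mem_univ f₁))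
  simp only [columns, e, List.range_succ_eq_map, List.map_cons, List.map_map]
  congr 1
  · funext f; simp [List.head?_eq_getElem?]
  · refine List.map_congr_left fun i _ => funext fun f => by simp

/-- The entries of the field `f` of a list of entries with field names. -/
def field [DecidableEq F] (f : F) (l : List (F × B)) : List B :=
  l.filterMap fun p => if p.1 = f then some p.2 else none

end columns

namespace Columns

variable {F B : Type}

/-- The alphabets of the stacks: one stack for every field, the input and the output. -/
abbrev Stack (F B : Type) : F ⊕ Bool → Type
  | .inl _ => B
  | .inr true => F × B
  | .inr false => F → Option B

/-- The labels: `none` writes a column, `some none` reads an entry, and `some (some p)` puts the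
entry `p` on the stack of its field. -/
abbrev Label (F B : Type) : Type := Option (Option (F × B))

/-- The entry read last, and the current column. -/
abbrev State (F B : Type) : Type := Option (F × B) × (F → Option B)

/-- The contents of the stacks. -/
def stk (i : List (F × B)) (s : F → List B) (o : List (F → Option B)) :
    ∀ k, List (Stack F B k)
  | .inl f => s f
  | .inr true => i
  | .inr false => o

variable [DecidableEq F]

/-- Pop the stacks of the listed fields and record what was on top. -/
def popFields : List F → TM2.Stmt (Stack F B) (Label F B) (State F B) →
    TM2.Stmt (Stack F B) (Label F B) (State F B)
  | [], q => q
  | f :: fs, q => .pop (Sum.inl f) (fun s o => (s.1, Function.update s.2 f o)) (popFields fs q)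

theorem update_inl (i : List (F × B)) (s : F → List B) (o : List (F → Option B)) (f : F)
    (l : List B) : Function.update (β := fun k => List (Stack F B k)) (stk i s o) (Sum.inl f) l =
      stk i (Function.update s f l) o := by
  funext k
  rcases k with g | b
  · by_cases h : g = f
    · subst h
      refine (Function.update_self _ _ _).trans ?_
      simp [stk]
    · refine (Function.update_of_ne (by simpa using h) _ _).trans ?_
      simp [stk, h]
  · refine (Function.update_of_ne (by simp) _ _).trans ?_
    cases b <;> rfl

theorem stepAux_popFields {fs : List F} (hfs : fs.Nodup)
    (q : TM2.Stmt (Stack F B) (Label F B) (State F B)) (u : Option (F × B)) (c : F → Option B)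
    (i : List (F × B)) (s : F → List B) (o : List (F → Option B)) :
    TM2.stepAux (popFields fs q) (u, c) (stk i s o) =
      TM2.stepAux q (u, fun f => if f ∈ fs then (s f).head? else c f)
        (stk i (fun f => if f ∈ fs then (s f).tail else s f) o) := by
  induction fs generalizing c s with
  | nil => simp [popFields]
  | cons g fs ih =>
    obtain ⟨hg, hfs⟩ := List.nodup_cons.1 hfs
    simp only [popFields, TM2.stepAux]
    rw [update_inl, ih hfs]
    congr 2
    · funext f
      by_cases h : f = g
      · subst h; simp [hg, stk]
      · simp [h]
    · funext f
      by_cases h : f = g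
      · subst h; simp [hg, stk]
      · simp [h]

variable [Fintype F]

/-- The program: distribute the entries to the stacks of their fields, and then pop all these
stacks at once until they are empty. -/
def code : Label F B → TM2.Stmt (Stack F B) (Label F B) (State F B)
  | some none => .pop (Sum.inr true) (fun s o => (o, s.2)) <|
      .goto fun s => s.1.elim none fun p => some (some p)
  | some (some (f, b)) => .push (Sum.inl f) (fun _ => b) <|
      .load (fun s => (none, s.2)) <| .goto fun _ => some none
  | none => popFields Finset.univ.toList <| .branch (fun s => decide (∃ f, (s.2 f).isSome))
      (.push (Sum.inr false) (fun s => s.2) <| .goto fun _ => none) .halt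

theorem runs_read (l : List (F × B)) (s : F → List B) :
    RunsIn (TM2.step code) (2 * l.length + 1)
      ⟨some (some none), (none, fun _ => none), stk l s []⟩
      ⟨some none, (none, fun _ => none), stk [] (fun f => (field f l).reverse ++ s f) []⟩ := by
  induction l generalizing s with
  | nil =>
    refine RunsIn.single (step_eq rfl rfl fun k => ?_)
    rcases k with f | _ | _ <;> rfl
  | cons p l ih =>
    obtain ⟨f, b⟩ := p
    refine RunsIn.head (n := 2 * l.length + 1 + 1)
      (b := ⟨some (some (some (f, b))), (some (f, b), fun _ => none), stk l s []⟩)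
      (step_eq rfl rfl fun k => ?_)
      (RunsIn.head (n := 2 * l.length + 1) (b := ⟨some (some none), (none, fun _ => none),
        stk l (Function.update s f (b :: s f)) []⟩) (congrArg some ?_) ?_)
    · rcases k with f | _ | _ <;> rfl
    · simp only [code, TM2.stepAux]
      exact congrArg (TM2.Cfg.mk _ _) (update_inl _ _ _ _ _)
    · have e : (fun g => (field g ((f, b) :: l)).reverse ++ s g) =
          fun g => (field g l).reverse ++ Function.update s f (b :: s f) g := by
        funext g
        by_cases h : f = g
        · subst h; simp [field]
        · have h' : g ≠ f := fun e => h e.symm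
          simp [field, h, h']
      rw [e]
      exact ih _

theorem runs_write (s : F → List B) (c : F → Option B) (o : List (F → Option B)) :
    RunsIn (TM2.step code) ((columns s).length + 1)
      ⟨some none, (none, c), stk [] s o⟩
      ⟨none, (none, fun _ => none), stk [] (fun _ => []) ((columns s).reverse ++ o)⟩ := by
  generalize hn : (columns s).length = n
  induction n generalizing s c o with
  | zero =>
    have h : ∀ f, s f = [] := by
      intro f
      by_contra h
      rw [columns_eq_cons h] at hn
      simp at hn
    obtain rfl : s = fun _ => [] := funext h
    refine RunsIn.single (congrArg some ?_)
    simp only [code]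
    rw [stepAux_popFields (Finset.nodup_toList _)]
    simp [columns_eq_nil]
  | succ n ih =>
    obtain ⟨f₀, h₀⟩ : ∃ f, s f ≠ [] := by
      by_contra! h
      rw [columns_eq_nil h] at hn
      simp at hn
    rw [columns_eq_cons h₀] at hn ⊢
    refine RunsIn.head (b := ⟨some none, (none, fun f => (s f).head?),
      stk [] (fun f => (s f).tail) ((fun f => (s f).head?) :: o)⟩) (congrArg some ?_) ?_
    · simp only [code]
      rw [stepAux_popFields (Finset.nodup_toList _)]
      have h : ∃ f, ((s f).head?).isSome := ⟨f₀, by simpa using h₀⟩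
      simp only [Finset.mem_toList, Finset.mem_univ, if_true, TM2.stepAux, h, decide_true, cond]
      refine congrArg (TM2.Cfg.mk _ _) (funext fun k => ?_)
      rcases k with f | _ | _ <;> rfl
    · simpa using ih (fun f => (s f).tail) (fun f => (s f).head?) _ (by simpa using hn)

end Columns

/-- The entries of a list are sorted by field names, and the fields are read in parallel. -/
theorem polyTime_columns {F B : Type} [Fintype F] [DecidableEq F] [Fintype B] :
    PolyTime fun l : List (F × B) => columns fun f => field f l := by
  have h : PolyTime fun l : List (F × B) => (columns fun f => (field f l).reverse).reverse := by
    let tm : FinTM2 :=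
      { K := F ⊕ Bool
        k₀ := Sum.inr true
        k₁ := Sum.inr false
        Γ := Columns.Stack F B
        Λ := Columns.Label F B
        main := some none
        σ := Columns.State F B
        initialState := (none, fun _ => none)
        Γk₀Fin := inferInstanceAs (Fintype (F × B))
        m := Columns.code }
    refine PolyTimeVia.of_runs tm (Equiv.refl (F × B)) (Equiv.refl (F → Option B))
      ((2 * Polynomial.X + 1) + (Polynomial.X + 1)) fun l => ⟨(2 * l.length + 1) +
        ((columns fun f => (field f l).reverse ++ []).length + 1), ?_, ?_⟩
    · have : (columns fun f => (field f l).reverse).length ≤ l.length := by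
        simp only [columns, List.length_map, List.length_range]
        refine Finset.sup_le fun f _ => ?_
        rw [List.length_reverse]
        exact List.length_filterMap_le _ _
      simp
      omega
    · have h := (Columns.runs_read l fun _ => []).trans
        (Columns.runs_write (fun f => (field f l).reverse ++ []) (fun _ => none) [])
      have e₁ : Function.update (β := fun k => List (Columns.Stack F B k)) (fun _ => [])
          (Sum.inr true) l = Columns.stk l (fun _ => []) [] := by
        funext k; rcases k with f | _ | _ <;> rfl
      have e₂ (w : List (F → Option B)) : Function.update
          (β := fun k => List (Columns.Stack F B k)) (fun _ => []) (Sum.inr false) w =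
            Columns.stk [] (fun _ => []) w := by
        funext k; rcases k with f | _ | _ <;> rfl
      rw [← e₁, ← e₂] at h
      simp only [List.append_nil] at h ⊢
      have e₃ : l.map (Equiv.refl (F × B)).symm = l := List.map_id l
      have e₄ (w : List (F → Option B)) : w.map (Equiv.refl (F → Option B)).symm = w :=
        List.map_id w
      rw [e₄, id, e₃]
      exact h
  exact (PolyTimeVia.comp polyTime_reverse (PolyTimeVia.comp h polyTime_reverse)).congr id
    (fun _ => rfl) fun l => by simp [field, List.filterMap_reverse]

/-! ### Sorting by summands, and polynomials in unary -/

/-- Stable sorting: the two kinds of letters are separated. -/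
theorem polyTime_partition {A B : Type} [Fintype A] [Fintype B] :
    PolyTime fun l : List (A ⊕ B) =>
      (l.filterMap Sum.getLeft?).map Sum.inl ++ (l.filterMap Sum.getRight?).map Sum.inr := by
  -- two markers in front yield two copies of the list inside its product with itself
  let g : (Bool ⊕ (A ⊕ B)) × (Bool ⊕ (A ⊕ B)) → Option (A ⊕ B)
    | (.inl false, .inr (.inl a)) => some (.inl a)
    | (.inl true, .inr (.inr b)) => some (.inr b)
    | _ => none
  refine PolyTimeVia.congr (PolyTimeVia.comp (polyTime_filterMap g) (PolyTimeVia.comp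
    polyTime_product_self (PolyTimeVia.comp (polyTime_const_append [Sum.inl false, Sum.inl true])
      (polyTime_map (B := Bool ⊕ (A ⊕ B)) Sum.inr)))) id (fun _ => rfl) fun l => ?_
  have h₁ : ∀ l : List (A ⊕ B), l.filterMap (fun x => g (Sum.inl false, Sum.inr x)) =
      (l.filterMap Sum.getLeft?).map Sum.inl := by
    intro l
    rw [List.map_filterMap]
    congr 1
    funext x
    cases x <;> rfl
  have h₂ : ∀ l : List (A ⊕ B), l.filterMap (fun x => g (Sum.inl true, Sum.inr x)) =
      (l.filterMap Sum.getRight?).map Sum.inr := by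
    intro l
    rw [List.map_filterMap]
    congr 1
    funext x
    cases x <;> rfl
  have h₃ : ∀ x y, g (Sum.inr x, y) = none := fun x y => rfl
  have h₄ : ∀ b c, g (Sum.inl b, Sum.inl c) = none := by
    rintro (_ | _) c <;> rfl
  simp only [SProd.sprod, List.product, Function.comp, id, List.cons_append, List.nil_append,
    List.flatMap_cons, List.flatMap_map, List.filterMap_append, List.map_cons, List.filterMap_cons,
    h₄, List.filterMap_map, List.filterMap_flatMap, h₃]
  simp only [h₁, h₂]
  simp

/-- The value of a polynomial at the length of a word, in unary, behind the word; this is Horner's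
scheme. -/
theorem polyTime_unary_eval (p : Polynomial ℕ) :
    PolyTime fun x : List Bool =>
      x.map Sum.inl ++ List.replicate (p.eval x.length) (Sum.inr ()) := by
  induction p using Polynomial.recOnHorner with
  | M0 =>
    refine PolyTimeVia.congr (polyTime_map (B := Bool ⊕ Unit) Sum.inl) id (fun _ => rfl)
      fun x => ?_
    simp
  | MC p a _ _ ih =>
    refine PolyTimeVia.congr (PolyTimeVia.comp
      (polyTime_append_const (List.replicate a (Sum.inr () : Bool ⊕ Unit))) ih) id (fun _ => rfl)
      fun x => ?_
    simp
  | MX p _ ih =>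
    -- a marker in front yields one copy of `x`, and each letter of `x` one copy of the units
    let g : Option (Bool ⊕ Unit) × Option (Bool ⊕ Unit) → Option (Bool ⊕ Unit)
      | (none, some (.inl b)) => some (.inl b)
      | (some (.inl _), some (.inr _)) => some (.inr ())
      | _ => none
    refine PolyTimeVia.congr (PolyTimeVia.comp (polyTime_filterMap g) (PolyTimeVia.comp
      polyTime_product_self (PolyTimeVia.comp (polyTime_const_append [none])
        (PolyTimeVia.comp (polyTime_map some) ih)))) id (fun _ => rfl) fun x => ?_
    have h₁ : ∀ x : List Bool, x.filterMap (fun b => g (none, some (Sum.inl b))) =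
        x.map Sum.inl := fun x => List.filterMap_eq_map (f := Sum.inl) ▸ rfl
    have h₂ : ∀ u, g (none, some (Sum.inr u)) = none := fun _ => rfl
    have h₃ : ∀ u c, g (some (Sum.inr u), c) = none := by rintro _ (_ | _ | _) <;> rfl
    have h₄ : ∀ b c, g (some (Sum.inl b), some (Sum.inl c)) = none := fun _ _ => rfl
    have h₅ : ∀ b u, g (some (Sum.inl b), some (Sum.inr u)) = some (Sum.inr ()) := fun _ _ => rfl
    have h₆ : ∀ c, g (c, none) = none := by rintro (_ | _ | _) <;> rfl
    have h₇ : ∀ n, (List.replicate n (none, some (Sum.inr ()))).filterMap g = [] := fun n => by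
      simp [h₂]
    have h₈ : ∀ n b, (List.replicate n (some (Sum.inl b), some (Sum.inr ()))).filterMap g =
        List.replicate n (Sum.inr ()) := fun n b => by
      simp [h₅]
    have h₉ : ∀ n (x : List Bool), x.flatMap (fun _ => List.replicate n (Sum.inr ())) =
        List.replicate (n * x.length) (Sum.inr () : Bool ⊕ Unit) := by
      intro n x
      induction x with
      | nil => simp
      | cons b x ih => simp [ih, Nat.mul_succ, Nat.add_comm]
    have h₁₀ : ∀ m n : ℕ, (List.replicate m (some (Sum.inr ()))).flatMap (fun a =>
        x.filterMap (fun b => g (a, some (Sum.inl b))) ++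
          (List.replicate n (a, some (Sum.inr ()))).filterMap g) = [] := fun m n => by
      rw [List.flatMap_eq_nil_iff]
      intro a ha
      obtain rfl := List.eq_of_mem_replicate ha
      simp [h₃]
    simp only [SProd.sprod, List.product, Function.comp, id, List.cons_append, List.nil_append,
      List.flatMap_cons, List.flatMap_map, List.filterMap_append, List.map_cons,
      List.filterMap_cons, List.filterMap_map, List.filterMap_flatMap, Function.comp_def,
      List.map_append, List.map_map, List.flatMap_append, List.map_replicate, h₁, h₄, h₆]
    simp [h₇, h₈, h₉, h₁₀]

/-! ### The schema -/

/-- One ternary relation: a word, a string whose length bounds the certificates for the word, and a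
string whose length is the weight of these certificates. -/
abbrev wordSig : Signature := ⟨1, fun _ => 3⟩

/-- The relation, applied to the last three of six bound variables. -/
def wordAtom : wordSig.lang.BoundedFormula Empty 6 :=
  FirstOrder.Language.Relations.boundedFormula (L := wordSig.lang)
    (FORelation.rel (0 : Fin 1) : FORelation wordSig 3)
    (![.var (.inr 3), .var (.inr 4), .var (.inr 5)] : Fin 3 → wordSig.lang.Term (Empty ⊕ Fin 6))

/-- Equality of two of six bound variables. -/
def varEq (i j : Fin 6) : wordSig.lang.BoundedFormula Empty 6 :=
  FirstOrder.Language.Term.bdEqual (.var (.inr i)) (.var (.inr j))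

/-- There is exactly one fact: there are a word, a bound and a weight such that precisely these
are related. -/
def oneFact : wordSig.lang.Sentence :=
  (wordAtom.iff (varEq 3 0 ⊓ (varEq 4 1 ⊓ varEq 5 2))).all.all.all.ex.ex.ex

/-- The schema whose instances consist of a single fact. -/
abbrev wordSchema : Schema where
  toSignature := wordSig
  constraints := {oneFact}

/-- The fact with the given word, bound and weight. -/
def wordFact (x b z : Const) : Fact wordSig := ⟨(0 : Fin 1), ![x, b, z]⟩

theorem wordFact_inj {x b z x' b' z' : Const} :
    wordFact x b z = wordFact x' b' z' ↔ x = x' ∧ b = b' ∧ z = z' := by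
  simp [wordFact]

theorem eq_wordFact (f : Fact wordSig) : ∃ x b z, f = wordFact x b z := by
  obtain ⟨r, a⟩ := f
  obtain rfl : r = (0 : Fin 1) := Subsingleton.elim _ _
  exact ⟨a 0, a 1, a 2, congrArg (Fact.mk (G := wordSig) (0 : Fin 1))
    (funext fun i => by fin_cases i <;> rfl)⟩

theorem realize_oneFact (F : Finset (Fact wordSig)) :
    @FirstOrder.Language.Sentence.Realize wordSig.lang Const (factStructure F) oneFact ↔
      ∃ x b z, F = {wordFact x b z} := by
  let _ : wordSig.lang.Structure Const := factStructure F
  have h : ∀ (v : Empty → Const) (xs : Fin 6 → Const),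
      wordAtom.Realize v xs ↔ wordFact (xs 3) (xs 4) (xs 5) ∈ F := by
    intro v xs
    change (⟨(0 : Fin 1), fun i => FirstOrder.Language.Term.realize (Sum.elim v xs)
      ((![.var (.inr 3), .var (.inr 4), .var (.inr 5)] :
        Fin 3 → wordSig.lang.Term (Empty ⊕ Fin 6)) i)⟩ : Fact wordSig) ∈ F ↔ _
    have e : (fun i => FirstOrder.Language.Term.realize (Sum.elim v xs)
      ((![.var (.inr 3), .var (.inr 4), .var (.inr 5)] :
        Fin 3 → wordSig.lang.Term (Empty ⊕ Fin 6)) i)) = ![xs 3, xs 4, xs 5] := by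
      funext i; fin_cases i <;> rfl
    exact iff_of_eq (congrArg (fun a => (⟨(0 : Fin 1), a⟩ : Fact wordSig) ∈ F) e)
  have h' : ∀ (v : Empty → Const) (xs : Fin 6 → Const) i j,
      (varEq i j).Realize v xs ↔ xs i = xs j := by
    intro v xs i j
    simp [varEq]
  simp only [oneFact, FirstOrder.Language.Sentence.Realize, FirstOrder.Language.Formula.Realize,
    FirstOrder.Language.BoundedFormula.realize_ex, FirstOrder.Language.BoundedFormula.realize_all,
    FirstOrder.Language.BoundedFormula.realize_iff, FirstOrder.Language.BoundedFormula.realize_inf,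
    h, h']
  refine exists_congr fun x => exists_congr fun b => exists_congr fun z => ?_
  have e : ∀ u v w : Const, ∀ i : Fin 6,
      (Fin.snoc (Fin.snoc (Fin.snoc (Fin.snoc (Fin.snoc (Fin.snoc default x) b) z) u) v) w :
        Fin 6 → Const) i = ![x, b, z, u, v, w] i := by
    intro u v w i
    fin_cases i <;> rfl
  simp only [e]
  constructor
  · intro H
    ext f
    obtain ⟨u, v, w, rfl⟩ := eq_wordFact f
    rw [Finset.mem_singleton, wordFact_inj]
    exact H u v w
  · rintro rfl u v w
    simp [wordFact_inj]

theorem Instance.exists_facts_eq (I : Instance wordSchema) :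
    ∃ x b z, I.facts = {wordFact x b z} :=
  (realize_oneFact I.facts).1 (I.sat oneFact (Finset.mem_singleton_self _))

/-- The instance with a single fact. -/
def wordInstance (x b z : Const) : Instance wordSchema where
  facts := {wordFact x b z}
  sat φ hφ := by
    rw [Finset.mem_singleton.1 hφ]
    exact (realize_oneFact _).2 ⟨x, b, z, rfl⟩

theorem Instance.EncodedBy.eq {I : Instance wordSchema} {x b z : Const}
    (hI : I.facts = {wordFact x b z}) {w : List Γ'} (h : I.EncodedBy w) :
    w = encList [encFact (wordFact x b z)] := by
  obtain ⟨l, ⟨hl, hmem⟩, rfl⟩ := h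
  have : l = [wordFact x b z] := by
    have h₁ : ∀ f ∈ l, f = wordFact x b z := fun f hf => by
      simpa [hI] using (hmem f).1 hf
    have h₂ : wordFact x b z ∈ l := (hmem _).2 (by simp [hI])
    match l, hl, h₁, h₂ with
    | [f], _, h₁, _ => rw [h₁ f (by simp)]
    | f :: g :: l, hl, h₁, _ =>
      rw [h₁ f (by simp), h₁ g (by simp)] at hl
      simp at hl
  rw [this]
  rfl

theorem encFact_wordFact (x b z : Const) : encFact (wordFact x b z) =
    [Γ'.bra, Γ'.bra, Γ'.ket, Γ'.bra] ++ (encStr x.str ++ encStr b.str ++ encStr z.str) ++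
      [Γ'.ket, Γ'.ket] := by
  have h : encConsts (wordFact x b z).args =
      encList [encStr x.str, encStr b.str, encStr z.str] := rfl
  have h' : encNum 0 = [Γ'.bra, Γ'.ket] := rfl
  simp [encFact, h, h', encList]

/-! ### The extensions -/

/-- The extension of a concept in a set of facts. The concept `false :: c` is the nominal of the
constant `c`. The concept `true :: y` is non-empty if `y` is a certificate, of admissible length,
for the word of a fact; its elements are then the strings of ones up to the weight of that fact. -/
def certExt (v : List Bool × List Bool → Bool) : List Bool → Finset (Fact wordSig) → Set Const
  | [], _ => ∅
  | false :: c, _ => {⟨c⟩}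
  | true :: y, F => {c | ∃ x b z, wordFact x b z ∈ F ∧ y.length ≤ b.str.length ∧
      v (x.str, y) = true ∧ ∃ i ≤ z.str.length, c = ⟨List.replicate i true⟩}

theorem mem_certExt_true {v : List Bool × List Bool → Bool} {y : List Bool} {x b z c : Const} :
    c ∈ certExt v (true :: y) {wordFact x b z} ↔ y.length ≤ b.str.length ∧ v (x.str, y) = true ∧
      ∃ i ≤ z.str.length, c = ⟨List.replicate i true⟩ := by
  constructor
  · rintro ⟨x', b', z', h, h'⟩
    obtain ⟨rfl, rfl, rfl⟩ := wordFact_inj.1 (Finset.mem_singleton.1 h)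
    exact h'
  · exact fun h => ⟨x, b, z, Finset.mem_singleton_self _, h⟩

/-! ### Parsing membership questions -/

/-- The parts of a membership question that matter: the first letter of the concept, the rest of
the concept, the three strings of the instance, and the constant. -/
inductive Field
  | kind
  | cert
  | word
  | bound
  | weight
  | const
  deriving DecidableEq

instance : Fintype Field :=
  ⟨{.kind, .cert, .word, .bound, .weight, .const}, fun k => by cases k <;> simp⟩

namespace Parse

/-- The parser counts opening brackets; the state `11` is that of the second bracket after the
first letter of the concept. -/
def next (q : Fin 12) : Γ' → Fin 12
  | .bra => if q = 11 then 3 else if q = 10 then 10 else q + 1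
  | .bit _ => if q = 2 then 11 else q
  | _ => q

/-- The field to which a letter belongs. -/
def tag : Fin 12 → Option Field
  | 2 => some .kind
  | 11 => some .cert
  | 7 => some .word
  | 8 => some .bound
  | 9 => some .weight
  | 10 => some .const
  | _ => none

/-- The output of the parser. -/
def out (q : Fin 12) : Γ' → List (Field × Bool)
  | .bit b => (tag q).toList.map fun f => (f, b)
  | _ => []

/-- Sort the letters of a membership question into fields. -/
def parse : List Γ' → List (Field × Bool) := transduce next out (fun _ => []) 0

theorem transduce_bits {q : Fin 12} {f : Field} (hq : q ≠ 2) (hf : tag q = some f) (w : List Bool)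
    (l : List Γ') : transduce next out (fun _ => []) q (w.map Γ'.bit ++ l) =
      w.map (fun b => (f, b)) ++ transduce next out (fun _ => []) q l := by
  induction w with
  | nil => rfl
  | cons b w ih => simp [transduce, next, out, hq, hf, ih]

theorem parse_cons (k : Bool) (y : List Bool) (x b z c : Const) :
    parse (encList [encStr (k :: y), encList [encFact (wordFact x b z)], encStr c.str]) =
      (Field.kind, k) :: (y.map (fun b => (Field.cert, b)) ++
        x.str.map (fun b => (Field.word, b)) ++
        b.str.map (fun b => (Field.bound, b)) ++ z.str.map (fun b => (Field.weight, b)) ++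
        c.str.map (fun b => (Field.const, b))) := by
  have h₁₁ := fun w l => transduce_bits (q := 11) (by decide) rfl w l
  have h₇ := fun w l => transduce_bits (q := 7) (by decide) rfl w l
  have h₈ := fun w l => transduce_bits (q := 8) (by decide) rfl w l
  have h₉ := fun w l => transduce_bits (q := 9) (by decide) rfl w l
  have h₁₀ := fun w l => transduce_bits (q := 10) (by decide) rfl w l
  rw [encFact_wordFact]
  simp [parse, encList, encStr, transduce, next, out, tag, h₁₁, h₇, h₈, h₉, h₁₀]

theorem parse_nil (x b z c : Const) :
    parse (encList [encStr [], encList [encFact (wordFact x b z)], encStr c.str]) =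
      x.str.map (fun b => (Field.word, b)) ++
        b.str.map (fun b => (Field.bound, b)) ++ z.str.map (fun b => (Field.weight, b)) ++
        c.str.map (fun b => (Field.const, b)) := by
  have h₇ := fun w l => transduce_bits (q := 7) (by decide) rfl w l
  have h₈ := fun w l => transduce_bits (q := 8) (by decide) rfl w l
  have h₉ := fun w l => transduce_bits (q := 9) (by decide) rfl w l
  have h₁₀ := fun w l => transduce_bits (q := 10) (by decide) rfl w l
  rw [encFact_wordFact]
  simp [parse, encList, encStr, transduce, next, out, h₇, h₈, h₉, h₁₀]

end Parse

/-! ### Translating membership questions to questions for the verifier -/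

section columns

variable {F B : Type} [Fintype F]

theorem forall_mem_columns {s : F → List B} {P : (F → Option B) → Prop} (h : P fun _ => none) :
    (∀ c ∈ columns s, P c) ↔ ∀ i : ℕ, P fun f => (s f)[i]? := by
  simp only [columns, List.mem_map, List.mem_range, forall_exists_index, and_imp,
    forall_apply_eq_imp_iff₂]
  refine ⟨fun H i => ?_, fun H i _ => H i⟩
  by_cases hi : i < Finset.univ.sup fun f => (s f).length
  · exact H i hi
  · have : (fun f => (s f)[i]?) = fun _ => none := by
      funext f
      exact List.getElem?_eq_none ((Finset.le_sup (f := fun f => (s f).length)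
        (Finset.mem_univ f)).trans (not_lt.1 hi))
    rwa [this]

/-- Reading one field of all columns gives back the list of that field. -/
theorem filterMap_columns (s : F → List B) (f : F) :
    (columns s).filterMap (fun c => c f) = s f := by
  generalize hn : (columns s).length = n
  induction n generalizing s with
  | zero =>
    have h : s f = [] := by
      by_contra h
      rw [columns_eq_cons h] at hn
      simp at hn
    rw [List.length_eq_zero_iff.1 hn, h]
    rfl
  | succ n ih =>
    obtain ⟨g, hg⟩ : ∃ g, s g ≠ [] := by
      by_contra! h
      rw [columns_eq_nil h] at hn
      simp at hn
    rw [columns_eq_cons hg] at hn ⊢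
    have := ih (fun f => (s f).tail) (by simpa using hn)
    rw [List.filterMap_cons, this]
    cases h : s f <;> simp [h]

end columns

theorem forall_getElem?_isSome {A B : Type} (l : List A) (m : List B) :
    (∀ i : ℕ, l[i]?.isSome → m[i]?.isSome) ↔ l.length ≤ m.length := by
  constructor
  · intro h
    by_contra! h'
    simpa using h m.length (by simpa using h')
  · intro h i hi
    simp at hi ⊢
    omega

theorem forall_getElem?_true (l : List Bool) {A : Type} (m : List A) :
    (∀ i : ℕ, l[i]? = none ∨ l[i]? = some true ∧ m[i]?.isSome) ↔
      ∃ i ≤ m.length, l = List.replicate i true := by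
  constructor
  · intro h
    refine ⟨l.length, (forall_getElem?_isSome l m).1 fun i hi => ?_, ?_⟩
    · rcases h i with h | h
      · simp [h] at hi
      · exact h.2
    · refine List.eq_replicate_of_mem fun b hb => ?_
      obtain ⟨i, hi, rfl⟩ := List.getElem_of_mem hb
      have := h i
      simp only [List.getElem?_eq_getElem hi] at this
      simpa using (this.resolve_left (by simp)).1
  · rintro ⟨n, hn, rfl⟩ i
    by_cases h : i < n
    · right
      simp [h]
      omega
    · left
      simp [h]

namespace Decide

/-- The columns of the fields of a membership question. -/
abbrev Column : Type := Field → Option Bool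

/-- What a membership question in a nominal requires of every column: the rest of the concept and
the constant agree. -/
def nominalOk (c : Column) : Bool := decide (c .cert = c .const)

/-- What a membership question for a certificate requires of every column: the certificate is not
longer than the bound, and the constant consists of ones and is not longer than the weight. -/
def certOk (c : Column) : Bool :=
  (!(c .cert).isSome || (c .bound).isSome) &&
    (decide (c .const = none) || (decide (c .const = some true) && (c .weight).isSome))

/-- The kind of the concept, and whether all columns up to now are as required of nominals and of
certificates. -/
abbrev State : Type := Option Bool × Bool × Bool

/-- The automaton that reads the columns. -/
def next (q : State) (c : Column) : State :=
  (q.1.or (c .kind), q.2.1 && nominalOk c, q.2.2 && certOk c)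

theorem foldl_next (l : List Column) (q : State) : l.foldl next q =
    (q.1.or (l.filterMap fun c => c .kind).head?, q.2.1 && l.all nominalOk,
      q.2.2 && l.all certOk) := by
  induction l generalizing q with
  | nil => simp
  | cons c l ih =>
    rw [List.foldl_cons, ih]
    simp only [next, List.filterMap_cons, List.all_cons, Bool.and_assoc]
    cases h : c .kind <;> simp

variable (accept reject : List Bool × List Bool)

/-- The pair for the verifier to which the columns are translated: it is the pair of the word and
the certificate, if the conditions on certificates are met, and a fixed pair otherwise. -/
def query (l : List Column) : List Bool × List Bool :=
  match l.foldl next (none, true, true) with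
  | (some true, _, true) => (l.filterMap fun c => c .word, l.filterMap fun c => c .cert)
  | (some false, true, _) => accept
  | _ => reject

theorem polyTime_query : PolyTimeVia (id : List Column → List Column)
    (encodingProd (encodingList Bool) (encodingList Bool)).encode (query accept reject) := by
  let run : State → Bool := fun q => decide (q.1 = some true) && q.2.2
  let f : State → Column → List (Bool ⊕ Bool) := fun q c =>
    if run q then (c .word).toList.map Sum.inl ++ (c .cert).toList.map Sum.inr else []
  let fin : State → List (Bool ⊕ Bool) := fun q =>
    if run q then [] else
      if q.1 = some false ∧ q.2.1 = true then accept.1.map Sum.inl ++ accept.2.map Sum.inr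
      else reject.1.map Sum.inl ++ reject.2.map Sum.inr
  refine PolyTimeVia.congr (PolyTimeVia.comp polyTime_partition
    (polyTime_flatMap_foldl next (none, true, true) f fin)) id (fun _ => rfl) fun l => ?_
  have h₁ : ∀ u w : List Bool, (u.map Sum.inl ++ w.map Sum.inr).filterMap Sum.getLeft? = u := by
    intro u w; simp [List.filterMap_map, Function.comp_def]
  have h₂ : ∀ u w : List Bool, (u.map Sum.inl ++ w.map Sum.inr).filterMap Sum.getRight? = w := by
    intro u w; simp [List.filterMap_map, Function.comp_def]
  have h₃ : ∀ l : List Column, (l.flatMap fun c => ((c .word).toList.map Sum.inl ++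
      (c .cert).toList.map Sum.inr : List (Bool ⊕ Bool))).filterMap Sum.getLeft? =
        l.filterMap fun c => c .word := by
    intro l
    simp only [List.filterMap_flatMap, h₁]
    exact (List.filterMap_eq_flatMap_toList _ _).symm
  have h₄ : ∀ l : List Column, (l.flatMap fun c => ((c .word).toList.map Sum.inl ++
      (c .cert).toList.map Sum.inr : List (Bool ⊕ Bool))).filterMap Sum.getRight? =
        l.filterMap fun c => c .cert := by
    intro l
    simp only [List.filterMap_flatMap, h₂]
    exact (List.filterMap_eq_flatMap_toList _ _).symm
  have h₅ : ∀ l : List Column, l.flatMap (fun _ => ([] : List (Bool ⊕ Bool))) = [] := by simp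
  simp only [Function.comp, id, query, encodingProd, encodingList]
  rcases l.foldl next (none, true, true) with ⟨_ | _ | _, _ | _, _ | _⟩ <;>
    simp [f, fin, run, h₁, h₂, h₃, h₄, h₅]

/-- The verifier accepts the translation of a membership question precisely if the constant belongs
to the extension. -/
theorem query_spec {v : List Bool × List Bool → Bool} (ha : v accept = true) (hr : v reject = false)
    (C : List Bool) (x b z c : Const) :
    v (query accept reject (columns fun f => field f (Parse.parse
      (encList [encStr C, encList [encFact (wordFact x b z)], encStr c.str])))) = true ↔
        c ∈ certExt v C {wordFact x b z} := by
  rcases C with _ | ⟨k, y⟩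
  · rw [Parse.parse_nil]
    have hk : field Field.kind (x.str.map (fun b => (Field.word, b)) ++
        b.str.map (fun b => (Field.bound, b)) ++ z.str.map (fun b => (Field.weight, b)) ++
        c.str.map (fun b => (Field.const, b))) = [] := by
      simp [field, List.filterMap_map]
    simp only [query, foldl_next, filterMap_columns, hk]
    simp [hr, certExt]
  · rw [Parse.parse_cons]
    set S := (Field.kind, k) :: (y.map (fun b => (Field.cert, b)) ++
        x.str.map (fun b => (Field.word, b)) ++
        b.str.map (fun b => (Field.bound, b)) ++ z.str.map (fun b => (Field.weight, b)) ++
        c.str.map (fun b => (Field.const, b))) with hS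
    have hkind : field Field.kind S = [k] := by
      simp [hS, field, List.filterMap_map]
    have hcert : field Field.cert S = y := by simp [hS, field, List.filterMap_map]
    have hword : field Field.word S = x.str := by
      simp [hS, field, List.filterMap_map]
    have hbound : field Field.bound S = b.str := by
      simp [hS, field, List.filterMap_map]
    have hweight : field Field.weight S = z.str := by
      simp [hS, field, List.filterMap_map]
    have hconst : field Field.const S = c.str := by
      simp [hS, field, List.filterMap_map]
    clear_value S
    have hnom : (columns fun f => field f S).all nominalOk = true ↔ y = c.str := by
      rw [List.all_eq_true, forall_mem_columns (P := fun c => nominalOk c = true) (by rfl)]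
      simp only [nominalOk, decide_eq_true_eq, hcert, hconst]
      exact ⟨List.ext_getElem?, fun h i => by rw [h]⟩
    have hok : (columns fun f => field f S).all certOk = true ↔
        y.length ≤ b.str.length ∧ ∃ i ≤ z.str.length, c.str = List.replicate i true := by
      rw [List.all_eq_true, forall_mem_columns (P := fun c => certOk c = true) (by rfl),
        ← forall_getElem?_isSome, ← forall_getElem?_true, ← forall_and]
      refine forall_congr' fun i => ?_
      simp only [certOk, hcert, hconst, hbound, hweight, Bool.and_eq_true, Bool.or_eq_true,
        decide_eq_true_eq, Bool.not_eq_true']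
      refine and_congr_left fun _ => ?_
      cases y[i]?.isSome <;> simp
    simp only [query, foldl_next, filterMap_columns, hkind, hword, hcert]
    cases k
    · rw [certExt, Set.mem_singleton_iff, Const.ext_iff, eq_comm (a := c.str), ← hnom]
      cases h : (columns fun f => field f S).all nominalOk <;> simp [ha, hr]
    · rw [mem_certExt_true]
      simp only [Const.ext_iff]
      cases h : (columns fun f => field f S).all certOk
      · have : ¬ (y.length ≤ b.str.length ∧ ∃ i ≤ z.str.length, c.str = List.replicate i true) :=
          fun h' => by simp [hok.2 h'] at h
        simp only [List.head?_cons, Option.none_or, Bool.and_false, Bool.true_and, hr]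
        exact ⟨fun h' => by simp at h', fun h' => absurd ⟨h'.1, h'.2.2⟩ this⟩
      · have := hok.1 h
        simp
        tauto

end Decide

/-! ### P and NP -/

theorem polyTimeDecidable_const {A : Type} [Fintype A] (b : Bool) :
    PolyTimeDecidable fun _ : List A => b :=
  PolyTimeVia.congr (polyTime_const [b]) id (fun _ => rfl) fun _ => rfl

theorem classP_subset_classNP : classP ⊆ classNP := by
  rintro L ⟨d, hd, hL⟩
  refine ⟨fun z => d z.1, 0, ?_, fun x => ⟨fun h => ⟨[], by simp, (hL x).1 h⟩,
    fun ⟨_, _, h⟩ => (hL x).2 h⟩⟩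
  refine PolyTimeVia.congr (PolyTimeVia.comp hd
    (polyTime_filterMap (Sum.getLeft? : Bool ⊕ Bool → Option Bool)))
    (encodingProd (encodingList Bool) (encodingList Bool)).encode (fun _ => rfl) fun z => ?_
  have : (z.1.map Sum.inl ++ z.2.map Sum.inr : List (Bool ⊕ Bool)).filterMap Sum.getLeft? =
      z.1 := by simp [List.filterMap_map, Function.comp_def]
  simp [encodingProd, encodingList, this]

theorem univ_mem_classP : (Set.univ : Language Bool) ∈ classP :=
  ⟨fun _ => true, polyTimeDecidable_const true, fun x => iff_of_true (Set.mem_univ x) rfl⟩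

theorem empty_mem_classP : (∅ : Set (List Bool)) ∈ classP :=
  ⟨fun _ => false, polyTimeDecidable_const false, fun x =>
    iff_of_false (Set.notMem_empty x) (by simp)⟩

/-! ### The ontology -/

theorem encard_ones (n : ℕ) :
    {c : Const | ∃ i ≤ n, c = ⟨List.replicate i true⟩}.encard = (n + 1 : ℕ) := by
  have h : {c : Const | ∃ i ≤ n, c = ⟨List.replicate i true⟩} =
      (fun i : ℕ => (⟨List.replicate i true⟩ : Const)) '' (Finset.range (n + 1) : Set ℕ) := by
    ext c
    simp [eq_comm]
  rw [h, Function.Injective.encard_image, Set.encard_coe_eq_coe_finsetCard, Finset.card_range]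
  intro i j hij
  simpa using congrArg (fun c : Const => c.str.length) hij

variable {v : List Bool × List Bool → Bool}

/-- The ontology of certificates and nominals, in which no two different concepts are comparable.
Membership in extensions is decided by a run of the verifier `v`; questions that are settled without
it are translated to a fixed pair that `v` accepts or rejects. -/
def certOntology
    (hv : PolyTimeVia (encodingProd (encodingList Bool) (encodingList Bool)).encode encodeBool v)
    (ha : ∃ z, v z = true) (hr : ∃ z, v z = false) : Ontology wordSchema where
  concepts := Set.univ
  sub := Eq
  sub_refl _ _ := rfl
  sub_trans _ _ _ _ _ _ := Eq.trans
  ext C I := certExt v C I.facts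
  ext_polyTime := by
    obtain ⟨accept, ha⟩ := ha
    obtain ⟨reject, hr⟩ := hr
    refine ⟨_, PolyTimeVia.comp hv (PolyTimeVia.comp (Decide.polyTime_query accept reject)
      (PolyTimeVia.comp polyTime_columns (polyTime_transduce Parse.next Parse.out _ 0 :
        PolyTime Parse.parse))), fun C _ I x c hx => ?_⟩
    obtain ⟨y, b, z, hI⟩ := I.exists_facts_eq
    rw [hx.eq hI, hI]
    exact Decide.query_spec accept reject ha hr C y b z c

section tractable

variable
    (hv : PolyTimeVia (encodingProd (encodingList Bool) (encodingList Bool)).encode encodeBool v)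
    (ha : ∃ z, v z = true) (hr : ∃ z, v z = false)

theorem certOntology_consistent (I : Instance wordSchema) :
    (certOntology hv ha hr).Consistent I := by
  rintro C _ D _ rfl
  exact subset_rfl

theorem certOntology_conceptsPolyTime : (certOntology hv ha hr).ConceptsPolyTime :=
  ⟨fun _ => true, polyTimeDecidable_const true, fun C => iff_of_true (Set.mem_univ C) rfl⟩

theorem length_encFact (x b z : Const) : (encFact (wordFact x b z)).length =
    x.str.length + b.str.length + z.str.length + 12 := by
  simp [encFact_wordFact, encStr]
  omega

theorem certOntology_smallExtensions : (certOntology hv ha hr).SmallExtensions := by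
  refine ⟨Polynomial.X + 1, fun C _ I w hw => ?_⟩
  obtain ⟨x, b, z, hI⟩ := I.exists_facts_eq
  have hlen : z.str.length ≤ w.length := by
    rw [hw.eq hI, encList]
    simp [length_encFact]
    omega
  simp only [Polynomial.eval_add, Polynomial.eval_X, Polynomial.eval_one, certOntology, hI]
  rcases C with _ | ⟨_ | _, y⟩
  · simp [certExt]
  · refine ⟨?_, ?_⟩
    · rw [certExt, Set.encard_singleton]
      exact_mod_cast Nat.le_add_left 1 _
    · rintro c rfl
      simp
      omega
  · refine ⟨(Set.encard_le_encard fun c hc => (mem_certExt_true.1 hc).2.2).trans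
      ((encard_ones z.str.length).trans_le ?_), fun c hc => ?_⟩
    · exact_mod_cast Nat.succ_le_succ (hlen.trans (Nat.le_add_left _ _))
    · obtain ⟨-, -, i, hi, rfl⟩ := mem_certExt_true.1 hc
      simp
      omega

theorem certOntology_shortExplanations : (certOntology hv ha hr).ShortExplanations := by
  refine ⟨Polynomial.X, fun w u _ hu E hE => ⟨E, hE, le_rfl, ?_⟩⟩
  obtain ⟨y, l, hy, -, rfl⟩ := hu
  obtain ⟨x, b, z, hI⟩ := w.inst.exists_facts_eq
  rw [hy.eq hI]
  have hmem := hE.2.1 0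
  simp only [certOntology, hI] at hmem
  simp only [Polynomial.eval_X, encList, List.length_cons, List.length_append, List.length_flatten,
    List.map_cons, List.map_nil, List.sum_cons, List.sum_nil, length_encFact, encConsts]
  rcases h : E 0 with _ | ⟨_ | _, C⟩
  · simp
  · rw [h] at hmem
    have : C.length = (w.tuple 0).str.length := by
      rw [show w.tuple 0 = ⟨C⟩ from hmem]
    simp [encStr, this]
    omega
  · rw [h] at hmem
    have := (mem_certExt_true.1 hmem).1
    simp
    omega

theorem certOntology_isMostGeneral_nominal (w : WhyNotInstance wordSchema 1) :
    IsMostGeneral (certOntology hv ha hr) w ![false :: (w.tuple 0).str] := by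
  refine ⟨⟨fun i => Set.mem_univ _, fun i => ?_, fun t ht h => ?_⟩, ?_⟩
  · obtain rfl := Subsingleton.elim i 0
    rfl
  · have h0 : t 0 = w.tuple 0 := h 0
    refine w.not_mem (?_ : w.tuple ∈ w.ans)
    rwa [show w.tuple = t from funext fun i => by rw [Subsingleton.elim i 0, h0]]
  · rintro ⟨E', -, h, h'⟩
    exact h' fun i => (h i).symm

/-- The nominal of the missing constant can be read off the end of the input. -/
theorem certOntology_mostGeneralPolyTime : (certOntology hv ha hr).MostGeneralPolyTime := by
  -- a state says whether the last string has been left, reading from right to left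
  let next : Option Bool → Γ' → Option Bool := fun q a => match q, a with
    | some false, .ket => some false
    | some _, .bit _ => some true
    | _, _ => none
  let out : Option Bool → Γ' → List Γ' := fun q a => match q, a with
    | some _, .bit b => [.bit b]
    | _, _ => []
  have h₀ : ∀ l, transduce next out (fun _ => []) none l = [] := by
    intro l
    induction l with
    | nil => rfl
    | cons a l ih => simp [transduce, next, out, ih]
  have h₁ : ∀ (c : List Bool) l, transduce next out (fun _ => []) (some true)
      (c.map Γ'.bit ++ Γ'.bra :: l) = c.map Γ'.bit := by
    intro c l
    induction c with
    | nil => simp [transduce, next, out, h₀]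
    | cons b c ih => simpa [transduce, next, out] using ih
  have h₂ : ∀ (c : List Bool) l, transduce next out (fun _ => []) (some false)
      (c.map Γ'.bit ++ Γ'.bra :: l) = c.map Γ'.bit := by
    intro c l
    cases c with
    | nil => simp [transduce, next, out, h₀]
    | cons b c => simpa [transduce, next, out] using h₁ c l
  refine ⟨_, PolyTimeVia.comp (polyTime_const_append [Γ'.bra, Γ'.bra, Γ'.bit false])
    (PolyTimeVia.comp (polyTime_append_const [Γ'.ket, Γ'.ket]) (PolyTimeVia.comp polyTime_reverse
      (PolyTimeVia.comp (polyTime_transduce next out (fun _ => []) (some false))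
        polyTime_reverse))), fun w u _ hu _ =>
          ⟨_, certOntology_isMostGeneral_nominal hv ha hr w, ?_⟩⟩
  obtain ⟨y, l, -, -, rfl⟩ := hu
  simp [encList, encConsts, encConcepts, encStr, transduce, next, out, ← List.map_reverse, h₂]

end tractable

/-! ### The reduction -/

/-- The why-not instance that asks for a certificate, of length at most `n`, for the word `x`; the
weight of such certificates is `r`. The query selects the facts whose bound is the string `0`; there
is none, and the question is why the empty string is no answer. -/
def certQuestion (x : List Bool) (n r : ℕ) : WhyNotInstance wordSchema 1 where
  inst := wordInstance ⟨x⟩ ⟨List.replicate n true⟩ ⟨List.replicate r true⟩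
  query :=
    { head := fun _ => 0
      atoms := [⟨(0 : Fin 1), ![Term.var 0, Term.const ⟨[false]⟩, Term.var 1]⟩]
      comparisons := []
      safe := fun _ => ⟨_, List.mem_singleton_self _, 0, rfl⟩ }
  ans := ∅
  ans_eq := by
    symm
    rw [Finset.coe_empty, Set.eq_empty_iff_forall_notMem]
    rintro t ⟨ν, h, -⟩
    have h := Finset.mem_singleton.1 (h _ (List.mem_singleton_self _))
    have h := congrArg (fun f : Fact wordSig => f.args 1) h
    have h : ([false] : List Bool) = List.replicate n true := congrArg Const.str h
    have := List.eq_of_mem_replicate (h ▸ List.mem_singleton_self false)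
    simp at this
  tuple _ := ⟨[]⟩
  not_mem := Finset.notMem_empty _

/-- What follows the bound in the description of `certQuestion`. -/
def certQuestionTail (r : ℕ) : List Γ' :=
  Γ'.ket :: (encStr (List.replicate r true) ++ [Γ'.ket, Γ'.ket, Γ'.ket] ++
    encCQ (certQuestion [] 0 0).query ++ encList [] ++ encConsts (certQuestion [] 0 0).tuple ++
      [Γ'.ket])

/-- A description of `certQuestion`. -/
def certQuestionCode (x : List Bool) (n r : ℕ) : List Γ' :=
  [Γ'.bra, Γ'.bra, Γ'.bra, Γ'.bra, Γ'.ket, Γ'.bra, Γ'.bra] ++ (x.map Γ'.bit ++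
    [Γ'.ket, Γ'.bra] ++ List.replicate n (Γ'.bit true) ++ certQuestionTail r)

theorem certQuestion_encodedBy (x : List Bool) (n r : ℕ) :
    (certQuestion x n r).EncodedBy (certQuestionCode x n r) := by
  refine ⟨encList [encFact (wordFact ⟨x⟩ ⟨List.replicate n true⟩ ⟨List.replicate r true⟩)], [],
    ⟨[_], ⟨List.nodup_singleton _, fun f => ?_⟩, rfl⟩, ⟨List.nodup_nil, fun f => ?_⟩, ?_⟩
  · exact List.mem_singleton.trans Finset.mem_singleton.symm
  · simp [certQuestion]
  · have h₁ : (certQuestion x n r).query = (certQuestion [] 0 0).query := rfl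
    have h₂ : (certQuestion x n r).tuple = (certQuestion [] 0 0).tuple := rfl
    rw [h₁, h₂, encFact_wordFact, certQuestionCode, certQuestionTail]
    simp [encList, encStr]

theorem polyTime_certQuestionCode (s : List Bool) (p : Polynomial ℕ) (r : ℕ) :
    PolyTime fun x : List Bool =>
      encList [encStr s, certQuestionCode x (p.eval x.length) r] := by
  -- the state says whether the units have been reached
  let next : Bool → Bool ⊕ Unit → Bool := fun q a => q || a.isRight
  let out : Bool → Bool ⊕ Unit → List Γ' := fun q a =>
    a.elim (fun b => [Γ'.bit b]) fun _ =>
      if q then [Γ'.bit true] else [Γ'.ket, Γ'.bra, Γ'.bit true]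
  let fin : Bool → List Γ' := fun q => if q then [] else [Γ'.ket, Γ'.bra]
  have h₁ : ∀ n, transduce next out fin true (List.replicate n (Sum.inr ())) =
      List.replicate n (Γ'.bit true) := by
    intro n
    induction n with
    | zero => simp [transduce, fin]
    | succ n ih => simp [transduce, next, out, ih, List.replicate_succ]
  have h₂ : ∀ (x : List Bool) n, transduce next out fin false
      (x.map Sum.inl ++ List.replicate n (Sum.inr ())) =
        x.map Γ'.bit ++ [Γ'.ket, Γ'.bra] ++ List.replicate n (Γ'.bit true) := by
    intro x n
    induction x with
    | nil =>
      cases n with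
      | zero => simp [transduce, fin]
      | succ n => simp [transduce, next, out, h₁, List.replicate_succ]
    | cons b x ih => simp [transduce, next, out] at ih ⊢; exact ih
  refine PolyTimeVia.congr (PolyTimeVia.comp (polyTime_const_append (Γ'.bra :: (encStr s ++
      [Γ'.bra, Γ'.bra, Γ'.bra, Γ'.bra, Γ'.ket, Γ'.bra, Γ'.bra])))
    (PolyTimeVia.comp (polyTime_append_const (certQuestionTail r ++ [Γ'.ket]))
      (PolyTimeVia.comp (polyTime_transduce next out fin false) (polyTime_unary_eval p))))
    id (fun _ => rfl) fun x => ?_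
  simp [h₂, certQuestionCode, encList]

/-- The third symbol of a description of a concept is the first letter of the concept. -/
theorem polyTimeDecidable_third :
    PolyTimeDecidable fun l : List Γ' => decide (l[2]? = some (Γ'.bit true)) := by
  let next : Fin 4 → Γ' → Fin 4 := fun q _ => if q = 3 then 3 else q + 1
  let out : Fin 4 → Γ' → List Bool := fun q a => if q = 2 then [decide (a = Γ'.bit true)] else []
  let fin : Fin 4 → List Bool := fun q => if q = 3 then [] else [false]
  have h : ∀ l, transduce next out fin 3 l = [] := by
    intro l
    induction l with
    | nil => rfl
    | cons a l ih => simpa [transduce, next, out] using ih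
  refine PolyTimeVia.congr (polyTime_transduce next out fin 0) id (fun _ => rfl) fun l => ?_
  match l with
  | [] => rfl
  | [_] => rfl
  | [_, _] => rfl
  | _ :: _ :: a :: l => simp [transduce, next, out, h, encodeBool]

section hardness

variable
    (hv : PolyTimeVia (encodingProd (encodingList Bool) (encodingList Bool)).encode encodeBool v)
    (ha : ∃ z, v z = true) (hr : ∃ z, v z = false)

theorem isExplanation_certQuestion (x : List Bool) (n r : ℕ) (E : Fin 1 → List Bool) :
    IsExplanation (certOntology hv ha hr) (certQuestion x n r) E ↔
      E 0 = [false] ∨ ∃ y, E 0 = true :: y ∧ y.length ≤ n ∧ v (x, y) = true := by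
  have h : IsExplanation (certOntology hv ha hr) (certQuestion x n r) E ↔
      (⟨[]⟩ : Const) ∈ certExt v (E 0)
        {wordFact ⟨x⟩ ⟨List.replicate n true⟩ ⟨List.replicate r true⟩} :=
    ⟨fun h => h.2.1 0, fun h => ⟨fun _ => Set.mem_univ _, fun i => by
      rw [Subsingleton.elim i 0]; exact h, fun t ht => absurd ht (Finset.notMem_empty t)⟩⟩
  rw [h]
  rcases E 0 with _ | ⟨_ | _, y⟩
  · simp [certExt]
  · rw [certExt, Set.mem_singleton_iff]
    simp [Const.ext_iff, eq_comm (a := ([] : List Bool))]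
  · rw [mem_certExt_true]
    simp only [List.length_replicate]
    constructor
    · exact fun h => Or.inr ⟨y, rfl, h.1, h.2.1⟩
    · rintro (h | ⟨y', h, h₁, h₂⟩)
      · simp at h
      · obtain rfl : y = y' := by simpa using h
        exact ⟨h₁, h₂, 0, Nat.zero_le _, rfl⟩

theorem degree_certQuestion_false (x : List Bool) (n r : ℕ) {E : Fin 1 → List Bool}
    (hE : E 0 = [false]) :
    degree (certOntology hv ha hr) (certQuestion x n r).inst E = 1 := by
  simp [degree, certOntology, hE, certExt]

theorem degree_certQuestion_true (x : List Bool) (n r : ℕ) {E : Fin 1 → List Bool} {y : List Bool}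
    (hE : E 0 = true :: y) (hy : y.length ≤ n) (hv' : v (x, y) = true) :
    degree (certOntology hv ha hr) (certQuestion x n r).inst E = (r + 1 : ℕ) := by
  have : certExt v (true :: y) {wordFact ⟨x⟩ ⟨List.replicate n true⟩ ⟨List.replicate r true⟩} =
      {c : Const | ∃ i ≤ r, c = ⟨List.replicate i true⟩} := by
    ext c
    simp [mem_certExt_true, hy, hv']
  rw [← encard_ones r, ← this, ← hE]
  simp [degree]
  rfl

theorem exists_isCardMaximal_certQuestion (x : List Bool) (n r : ℕ) :
    ∃ E, IsCardMaximal (certOntology hv ha hr) (certQuestion x n r) E := by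
  by_cases h : ∃ y, y.length ≤ n ∧ v (x, y) = true
  · obtain ⟨y, hy, hxy⟩ := h
    refine ⟨![true :: y], (isExplanation_certQuestion hv ha hr x n r _).2
      (Or.inr ⟨y, rfl, hy, hxy⟩), ?_⟩
    rintro ⟨E', hE', hlt⟩
    rw [degree_certQuestion_true hv ha hr x n r rfl hy hxy] at hlt
    rcases (isExplanation_certQuestion hv ha hr x n r E').1 hE' with h | ⟨y', h, h₁, h₂⟩
    · rw [degree_certQuestion_false hv ha hr x n r h] at hlt
      exact absurd hlt (not_lt.2 (by exact_mod_cast Nat.le_add_left 1 r))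
    · rw [degree_certQuestion_true hv ha hr x n r h h₁ h₂] at hlt
      exact lt_irrefl _ hlt
  · refine ⟨![[false]], (isExplanation_certQuestion hv ha hr x n r _).2 (Or.inl rfl), ?_⟩
    rintro ⟨E', hE', hlt⟩
    rcases (isExplanation_certQuestion hv ha hr x n r E').1 hE' with h' | ⟨y', h', h₁, h₂⟩
    · rw [degree_certQuestion_false hv ha hr x n r h',
        degree_certQuestion_false hv ha hr x n r rfl] at hlt
      exact lt_irrefl _ hlt
    · exact h ⟨y', h₁, h₂⟩

/-- An explanation that is maximal up to the factor `r` is given by a certificate as soon as there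
is one. -/
theorem IsCardApprox.head_certQuestion {x : List Bool} {n r : ℕ} {E : Fin 1 → List Bool}
    (h : IsCardApprox r (certOntology hv ha hr) (certQuestion x n r) E) :
    (encConcepts E)[2]? = some (Γ'.bit true) ↔ ∃ y, y.length ≤ n ∧ v (x, y) = true := by
  rcases (isExplanation_certQuestion hv ha hr x n r E).1 h.1 with hE | ⟨y, hE, h₁, h₂⟩
  · simp only [encConcepts, List.ofFn_succ, List.ofFn_zero, hE, encList, encStr]
    refine iff_of_false (by simp) ?_
    rintro ⟨y, h₁, h₂⟩
    have := h.2 ![true :: y] ((isExplanation_certQuestion hv ha hr x n r _).2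
      (Or.inr ⟨y, rfl, h₁, h₂⟩))
    rw [degree_certQuestion_true hv ha hr x n r rfl h₁ h₂,
      degree_certQuestion_false hv ha hr x n r hE, mul_one] at this
    exact absurd this (not_le.2 (by exact_mod_cast Nat.lt_succ_self r))
  · simp only [encConcepts, List.ofFn_succ, List.ofFn_zero, hE, encList, encStr]
    exact iff_of_true (by simp) ⟨y, h₁, h₂⟩

theorem mem_classP_of_produces {L : Language Bool} {p : Polynomial ℕ}
    (hL : ∀ x, x ∈ L ↔ ∃ y : List Bool, y.length ≤ p.eval x.length ∧ v (x, y) = true)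
    {F : OntologyFormat} (hF : ∃ s, F s = some ⟨wordSchema, certOntology hv ha hr⟩) {r : ℕ}
    {A : List Γ' → List Γ'} (hA : PolyTime A)
    (h : Produces F (fun O w E => IsCardApprox r O w E) A) : L ∈ classP := by
  obtain ⟨s, hs⟩ := hF
  refine ⟨_, PolyTimeVia.comp polyTimeDecidable_third
    (PolyTimeVia.comp hA (polyTime_certQuestionCode s p r)), fun x => ?_⟩
  obtain ⟨E, hE, hAE⟩ := h s wordSchema _ hs (certQuestion x (p.eval x.length) r) _ rfl
    (certOntology_consistent hv ha hr _) (certQuestion_encodedBy x _ r)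
    (exists_isCardMaximal_certQuestion hv ha hr x _ r)
  rw [hL, ← hE.head_certQuestion, ← hAE]
  simp

end hardness

theorem IsCardMaximal.isCardApprox_one {S : Schema} {m : ℕ} {O : Ontology S}
    {w : WhyNotInstance S m} {E : Fin m → List Bool} (h : IsCardMaximal O w E) :
    IsCardApprox 1 O w E :=
  ⟨h.1, fun E' hE' => by
    rw [Nat.cast_one, one_mul]
    exact not_lt.1 fun hlt => h.2 ⟨E', hE', hlt⟩⟩

end WhyNot

end

theorem mainTheorem11 (hPNP : WhyNot.classP ≠ WhyNot.classNP) :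
    ∃ (S : WhyNot.Schema) (O : WhyNot.Ontology S),
      (O.ConceptsPolyTime ∧ O.SmallExtensions ∧ O.ShortExplanations ∧ O.MostGeneralPolyTime) ∧
      ∀ F : WhyNot.OntologyFormat, (∃ s, F s = some ⟨S, O⟩) →
        (¬ ∃ A : List Computability.Γ' → List Computability.Γ', WhyNot.PolyTime A ∧
          WhyNot.Produces F (fun O w E => WhyNot.IsCardMaximal O w E) A) ∧
        ∀ r : ℕ, 1 ≤ r →
          ¬ ∃ A : List Computability.Γ' → List Computability.Γ', WhyNot.PolyTime A ∧
            WhyNot.Produces F (fun O w E => WhyNot.IsCardApprox r O w E) A := by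
  obtain ⟨L, ⟨v, p, hv, hL⟩, hLP⟩ : ∃ L ∈ WhyNot.classNP, L ∉ WhyNot.classP :=
    Set.not_subset.1 fun h => hPNP (WhyNot.classP_subset_classNP.antisymm h)
  -- if the verifier were constant, the language would be trivial
  have ha : ∃ z, v z = true := by
    by_contra! h
    have e : L = (∅ : Set (List Bool)) := Set.eq_empty_iff_forall_notMem.2 fun x hx => by
      obtain ⟨y, -, hy⟩ := (hL x).1 hx
      exact h _ hy
    exact hLP (e ▸ WhyNot.empty_mem_classP)
  have hr : ∃ z, v z = false := by
    by_contra! h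
    have e : L = (Set.univ : Set (List Bool)) := Set.eq_univ_of_forall fun x =>
      (hL x).2 ⟨[], by simp, by simpa using h (x, [])⟩
    exact hLP (e ▸ WhyNot.univ_mem_classP)
  refine ⟨WhyNot.wordSchema, WhyNot.certOntology hv ha hr,
    ⟨WhyNot.certOntology_conceptsPolyTime hv ha hr, WhyNot.certOntology_smallExtensions hv ha hr,
      WhyNot.certOntology_shortExplanations hv ha hr,
      WhyNot.certOntology_mostGeneralPolyTime hv ha hr⟩, fun F hF => ⟨?_, ?_⟩⟩
  · rintro ⟨A, hA, h⟩
    refine hLP (WhyNot.mem_classP_of_produces hv ha hr hL hF (r := 1) hA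
      fun s S O hs w x hq hI hx hE => ?_)
    obtain ⟨E, hE', hAE⟩ := h s S O hs w x hq hI hx hE
    exact ⟨E, hE'.isCardApprox_one, hAE⟩
  · rintro r - ⟨A, hA, h⟩
    exact hLP (WhyNot.mem_classP_of_produces hv ha hr hL hF hA h)
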